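/- Let $\Omega\subset\mathbb R^3$ be a bounded, open, connected polyhedral domain (its closure is a finite union of tetrahedra and $\Omega$ is the interior of its closure). Let $\Gamma=\partial\Omega$ have the connected components $\Gamma_0,\Gamma_1,\dots,\Gamma_L$ ($L\ge 0$), where $\Gamma_0$ is the exterior one, i.e. the one that contains the boundary of the unbounded component of $\mathbb R^3\setminus\overline\Omega$. Let $\boldsymbol n$ be the outward unit normal on $\Gamma$, let $\boldsymbol n_i$ be its restriction to $\Gamma_i$, and let $(\cdot,\cdot)$ denote the $L^2(\Omega)$ pairing. Let $\varepsilon=(\varepsilon_{ij})_{3\times3}$ have entries in $L^\infty(\Omega)$ and be symmetric and uniformly positive definite a.e. in $\Omega$. Let $f\in L^1(\Omega)$ be such that $f\varphi\in L^1(\Omega)$ for every $\varphi\in H^1(\Omega)$ (for instance $f\in L^2(\Omega)$), let $\boldsymbol g\in[L^2(\Omega)]^3$, and let $\phi_1\in H^{-1/2}(\Gamma)$, the dual of the trace space $H^{1/2}(\Gamma)\cong H^1(\Omega)/H^1_0(\Omega)$. Put $$H^1_{0c}(\Omega)=\{\phi\in H^1(\Omega):\ \phi|_{\Gamma_0}=0,\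 \phi|_{\Gamma_i}\text{ is constant for each } i=1,\dots,L\},$$ $$H_0(\mathrm{curl};\Omega)=\{\boldsymbol v\in[L^2(\Omega)]^3:\ \nabla\times\boldsymbol v\in[L^2(\Omega)]^3,\ \boldsymbol v\times\boldsymbol n=0\text{ on }\Gamma\},$$ where boundary values are understood in the sense of traces; for a field $\boldsymbol v\in[L^2(\Omega)]^3$ with distributional divergence $d$, the normal trace is defined by $\langle\boldsymbol v\cdot\boldsymbol n,\varphi\rangle=(\boldsymbol v,\nabla\varphi)+(d,\varphi)$ for $\varphi\in H^1(\Omega)$, and $\langle \boldsymbol v\cdot\boldsymbol n_i,1\rangle_{\Gamma_i}$ is its value at a $\varphi$ with $\varphi|_{\Gamma_i}=1$ and $\varphi|_{\Gamma_j}=0$ for $j\neq i$. Assume the compatibility condition $\nabla\cdot\boldsymbol g=0$ in $\Omega$ and $\langle\boldsymbol g\cdot\boldsymbol n_i,1\rangle_{\Gamma_i}=0$ for $i=1,\dots,L$. Let $(\boldsymbol u,s)\in[L^2(\Omega)]^3\times H^1_{0c}(\Omega)$ be any solution of the extended weak formulation $$(\boldsymbol u,\ \varepsilon\nabla\varphi+\nabla\times\boldsymbol\psi)+(\boldsymbol\psi,\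 \varepsilon\nabla s)=(\boldsymbol g,\boldsymbol\psi)-(f,\varphi)+\langle\phi_1,\varphi\rangle\qquad\forall\varphi\in H^1(\Omega),\ \forall\boldsymbol\psi\in H_0(\mathrm{curl};\Omega).$$ Then $$\nabla\cdot(\varepsilon\boldsymbol u)=f\ \text{ in }\Omega,\qquad \nabla\times\boldsymbol u=\boldsymbol g\ \text{ in }\Omega,\qquad s=0\ \text{ in }\Omega,\qquad \varepsilon\boldsymbol u\cdot\boldsymbol n=\phi_1\ \text{ on }\Gamma,$$ where the first two equations hold in the sense of distributions and the last one in $H^{-1/2}(\Gamma)$. -/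

import Mathlib

open MeasureTheory Filter Topology TopologicalSpace
open scoped ENNReal ContDiff Distributions

noncomputable section

namespace DivCurl

/-- Three-dimensional Euclidean space. -/
abbrev E3 : Type := EuclideanSpace ℝ (Fin 3)

/-! ### Polyhedral domains and the components of their boundary -/

/-- A polyhedral open set: it has no slits, and its closure is a finite union of (closed,
nondegenerate) tetrahedra. -/
def IsPolyhedral (Ω : Set E3) : Prop :=
  interior (closure Ω) = Ω ∧
    ∃ T : Set (Affine.Simplex ℝ E3 3), T.Finite ∧ closure Ω = ⋃ t ∈ T, t.closedInterior

/-- The union of the unbounded connected components of the complement of `closure Ω`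
(for a bounded `Ω` there is exactly one such component). -/
def exteriorRegion (Ω : Set E3) : Set E3 :=
  {x | x ∈ (closure Ω)ᶜ ∧ ¬ Bornology.IsBounded (connectedComponentIn (closure Ω)ᶜ x)}

/-- `Γ 0, …, Γ L` are the connected components of `∂Ω`, and `Γ 0` is the exterior one: it contains
the boundary of the exterior region. (Finitely many disjoint closed connected nonempty sets that
cover `∂Ω` are exactly its connected components.) -/
structure IsBoundaryDecomposition (Ω : Set E3) (L : ℕ) (Γ : Fin (L + 1) → Set E3) : Prop where
  isClosed : ∀ i, IsClosed (Γ i)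
  isConnected : ∀ i, IsConnected (Γ i)
  disjoint : ∀ i j, i ≠ j → Disjoint (Γ i) (Γ j)
  iUnion_eq : ⋃ i, Γ i = frontier Ω
  exterior : frontier (exteriorRegion Ω) ⊆ Γ 0

/-! ### `L²` and `H¹` -/

/-- `L²(Ω)`. -/
abbrev L2 (Ω : Opens E3) : Type := Lp ℝ 2 (volume.restrict (Ω : Set E3))

/-- `[L²(Ω)]³`. -/
abbrev L2Vec (Ω : Opens E3) : Type := Lp E3 2 (volume.restrict (Ω : Set E3))

theorem integrable_smul_of_memLp {Ω : Opens E3} {a : E3 → ℝ} {b : E3 → E3}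
    (ha : MemLp a 2 (volume.restrict (Ω : Set E3)))
    (hb : MemLp b 2 (volume.restrict (Ω : Set E3))) :
    Integrable (fun x => a x • b x) (volume.restrict (Ω : Set E3)) :=
  memLp_one_iff_integrable.1 (hb.smul ha)

theorem memLp_test {Ω : Opens E3} (η : 𝓓(Ω, ℝ)) :
    MemLp η 2 (volume.restrict (Ω : Set E3)) :=
  (η.continuous.memLp_of_hasCompactSupport η.hasCompactSupport).restrict _

theorem memLp_gradient_test {Ω : Opens E3} (η : 𝓓(Ω, ℝ)) :
    MemLp (gradient η) 2 (volume.restrict (Ω : Set E3)) := by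
  have hc : Continuous (fderiv ℝ η) := η.contDiff.continuous_fderiv (by simp)
  have hg : Continuous (gradient η) :=
    (InnerProductSpace.toDual ℝ E3).symm.continuous.comp hc
  have hs : HasCompactSupport (gradient η) :=
    (η.hasCompactSupport.fderiv ℝ).comp_left
      (g := fun l => (InnerProductSpace.toDual ℝ E3).symm l) (map_zero _)
  exact (hg.memLp_of_hasCompactSupport hs).restrict _

/-- The Sobolev space `H¹(Ω)`, as the Hilbert space of pairs `(φ, ∇φ)` with `φ ∈ L²(Ω)` and weak
gradient `∇φ ∈ [L²(Ω)]³`; the norm is `(‖φ‖² + ‖∇φ‖²)^(1/2)`. -/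
def H1 (Ω : Opens E3) : Submodule ℝ (WithLp 2 (L2 Ω × L2Vec Ω)) where
  carrier := {p | ∀ η : 𝓓(Ω, ℝ),
    ∫ x in (Ω : Set E3), p.fst x • gradient η x = - ∫ x in (Ω : Set E3), η x • p.snd x}
  zero_mem' := by
    intro η
    have h1 : ∫ x in (Ω : Set E3), (0 : L2 Ω) x • gradient η x = 0 := by
      rw [integral_congr_ae (g := fun _ => (0 : E3)), integral_zero]
      filter_upwards [Lp.coeFn_zero ℝ 2 (volume.restrict (Ω : Set E3))] with x hx
      rw [hx, Pi.zero_apply, zero_smul]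
    have h2 : ∫ x in (Ω : Set E3), η x • (0 : L2Vec Ω) x = 0 := by
      rw [integral_congr_ae (g := fun _ => (0 : E3)), integral_zero]
      filter_upwards [Lp.coeFn_zero E3 2 (volume.restrict (Ω : Set E3))] with x hx
      rw [hx, Pi.zero_apply, smul_zero]
    exact h1.trans (by rw [← neg_zero, ← h2]; rfl)
  add_mem' := by
    intro p q hp hq η
    have h1 : ∫ x in (Ω : Set E3), (p.fst + q.fst) x • gradient η x
        = (∫ x in (Ω : Set E3), p.fst x • gradient η x)
          + ∫ x in (Ω : Set E3), q.fst x • gradient η x := by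
      rw [← integral_add (integrable_smul_of_memLp (Lp.memLp _) (memLp_gradient_test η))
        (integrable_smul_of_memLp (Lp.memLp _) (memLp_gradient_test η))]
      apply integral_congr_ae
      filter_upwards [Lp.coeFn_add p.fst q.fst] with x hx
      rw [hx, Pi.add_apply, add_smul]
    have h2 : ∫ x in (Ω : Set E3), η x • (p.snd + q.snd) x
        = (∫ x in (Ω : Set E3), η x • p.snd x) + ∫ x in (Ω : Set E3), η x • q.snd x := by
      rw [← integral_add (integrable_smul_of_memLp (memLp_test η) (Lp.memLp _))
        (integrable_smul_of_memLp (memLp_test η) (Lp.memLp _))]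
      apply integral_congr_ae
      filter_upwards [Lp.coeFn_add p.snd q.snd] with x hx
      rw [hx, Pi.add_apply, smul_add]
    change ∫ x in (Ω : Set E3), (p.fst + q.fst) x • gradient η x
      = - ∫ x in (Ω : Set E3), η x • (p.snd + q.snd) x
    rw [h1, h2, hp η, hq η, neg_add]
  smul_mem' := by
    intro c p hp η
    have h1 : ∫ x in (Ω : Set E3), (c • p.fst) x • gradient η x
        = c • ∫ x in (Ω : Set E3), p.fst x • gradient η x := by
      rw [← integral_smul]
      apply integral_congr_ae
      filter_upwards [Lp.coeFn_smul c p.fst] with x hx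
      rw [hx, Pi.smul_apply, smul_assoc]
    have h2 : ∫ x in (Ω : Set E3), η x • (c • p.snd) x
        = c • ∫ x in (Ω : Set E3), η x • p.snd x := by
      rw [← integral_smul]
      apply integral_congr_ae
      filter_upwards [Lp.coeFn_smul c p.snd] with x hx
      rw [hx, Pi.smul_apply, smul_comm]
    change ∫ x in (Ω : Set E3), (c • p.fst) x • gradient η x
      = - ∫ x in (Ω : Set E3), η x • (c • p.snd) x
    rw [h1, h2, hp η, smul_neg]

/-- The underlying function of an element of `H¹(Ω)`. -/
def toL2 {Ω : Opens E3} (φ : H1 Ω) : L2 Ω := (φ : WithLp 2 (L2 Ω × L2Vec Ω)).fst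

/-- The weak gradient of an element of `H¹(Ω)`. -/
def grad {Ω : Opens E3} (φ : H1 Ω) : L2Vec Ω := (φ : WithLp 2 (L2 Ω × L2Vec Ω)).snd

/-! ### Boundary values -/

/-- The elements of `H¹(Ω)` that come from `C_c^∞(Ω)`. -/
def testH1 (Ω : Opens E3) : Submodule ℝ (H1 Ω) where
  carrier := {v | ∃ η : 𝓓(Ω, ℝ), toL2 v =ᵐ[volume.restrict (Ω : Set E3)] η}
  zero_mem' := ⟨0, Lp.coeFn_zero ℝ 2 (volume.restrict (Ω : Set E3))⟩
  add_mem' := by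
    rintro v w ⟨η, hη⟩ ⟨θ, hθ⟩
    refine ⟨η + θ, ?_⟩
    filter_upwards [hη, hθ, Lp.coeFn_add (toL2 v) (toL2 w)] with x h1 h2 h3
    exact h3.trans (by rw [Pi.add_apply, h1, h2]; rfl)
  smul_mem' := by
    rintro c v ⟨η, hη⟩
    refine ⟨c • η, ?_⟩
    filter_upwards [hη, Lp.coeFn_smul c (toL2 v)] with x h1 h2
    exact h2.trans (by rw [Pi.smul_apply, h1]; rfl)

/-- `H¹₀(Ω)`, the closure of `C_c^∞(Ω)` in `H¹(Ω)`, i.e. the kernel of the trace map. -/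
def H10 (Ω : Opens E3) : Submodule ℝ (H1 Ω) := (testH1 Ω).topologicalClosure

/-- The trace space `H^{1/2}(∂Ω)`, with its quotient norm. -/
abbrev TraceSpace (Ω : Opens E3) : Type := H1 Ω ⧸ H10 Ω

/-- The trace map `H¹(Ω) → H^{1/2}(∂Ω)`. -/
def trace (Ω : Opens E3) : H1 Ω →ₗ[ℝ] TraceSpace Ω := (H10 Ω).mkQ

/-- `H^{-1/2}(∂Ω)`, the dual of `H^{1/2}(∂Ω)`. -/
abbrev DualTraceSpace (Ω : Opens E3) : Type := TraceSpace Ω →L[ℝ] ℝ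

/-- The elements of `H¹(Ω)` that are smooth in `Ω` and attain the boundary value `α` on `S ⊆ ∂Ω`
in the classical sense. -/
def classicalBoundaryValue (Ω : Opens E3) (S : Set E3) (α : ℝ) : Set (H1 Ω) :=
  {v | ∃ w : E3 → ℝ, ContDiffOn ℝ ∞ w Ω ∧ toL2 v =ᵐ[volume.restrict (Ω : Set E3)] w ∧
    ∀ y ∈ S, Tendsto w (𝓝[(Ω : Set E3)] y) (𝓝 α)}

/-- `φ = α` on the closed part `S` of `∂Ω`, in the sense of traces: `φ` is a limit in `H¹(Ω)` of
functions that attain the boundary value `α` on `S` classically. -/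
def HasBoundaryValue {Ω : Opens E3} (φ : H1 Ω) (S : Set E3) (α : ℝ) : Prop :=
  φ ∈ closure (classicalBoundaryValue Ω S α)

/-- `H¹_{0c}(Ω)`: functions with value `0` on `Γ 0` and constant on each `Γ i`, `i = 1, …, L`. -/
def MemH10c {Ω : Opens E3} {L : ℕ} (Γ : Fin (L + 1) → Set E3) (φ : H1 Ω) : Prop :=
  HasBoundaryValue φ (Γ 0) 0 ∧ ∀ i : Fin L, ∃ α : ℝ, HasBoundaryValue φ (Γ i.succ) α

/-! ### Divergence and curl -/

/-- `∇·v = d` in `Ω`, in the sense of distributions. -/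
def HasWeakDiv (Ω : Opens E3) (v : E3 → E3) (d : E3 → ℝ) : Prop :=
  ∀ η : 𝓓(Ω, ℝ),
    ∫ x in (Ω : Set E3), inner ℝ (v x) (gradient η x) = - ∫ x in (Ω : Set E3), d x * η x

/-- The curl of a field `w` whose components have the gradients `J i = ∇wᵢ`. -/
def curlOfGradients (J : Fin 3 → E3) : E3 :=
  !₂[J 2 1 - J 1 2, J 0 2 - J 2 0, J 1 0 - J 0 1]

/-- The classical curl. -/
def curl (w : E3 → E3) (x : E3) : E3 := curlOfGradients fun i => gradient (fun y => w y i) x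

/-- `∇×v = c` in `Ω`, in the sense of distributions. -/
def HasWeakCurl (Ω : Opens E3) (v c : E3 → E3) : Prop :=
  ∀ w : 𝓓(Ω, E3),
    ∫ x in (Ω : Set E3), inner ℝ (v x) (curl w x) = ∫ x in (Ω : Set E3), inner ℝ (c x) (w x)

/-- `v ∈ H₀(curl;Ω)` with `∇×v = c`. The tangential trace `v × n ∈ [H^{-1/2}(∂Ω)]³` is defined by
Green's formula, `⟨v × n, w⟩ = (v, ∇×w) - (∇×v, w)` for `w ∈ [H¹(Ω)]³`, and it has to vanish. -/
def MemH0Curl {Ω : Opens E3} (v c : L2Vec Ω) : Prop :=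
  HasWeakCurl Ω v c ∧ ∀ w : Fin 3 → H1 Ω,
    ∫ x in (Ω : Set E3), inner ℝ (v x) (curlOfGradients fun i => grad (w i) x)
      = ∫ x in (Ω : Set E3), inner ℝ (c x) (WithLp.toLp 2 fun i => toL2 (w i) x)

/-- The value at (the trace of) `φ ∈ H¹(Ω)` of the normal trace `v·n` of a field `v` with
`∇·v = d`, by Green's formula: `⟨v·n, φ⟩ = (v, ∇φ) + (d, φ)`. -/
def normalTrace {Ω : Opens E3} (v : E3 → E3) (d : E3 → ℝ) (φ : H1 Ω) : ℝ :=
  (∫ x in (Ω : Set E3), inner ℝ (v x) (grad φ x)) + ∫ x in (Ω : Set E3), d x * toL2 φ x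

/-- `⟨v·n, 1⟩_{Γ i} = c` for a field `v` with `∇·v = d`: the normal trace takes the value `c` at the
indicator function of `Γ i`, i.e. at an `H¹(Ω)` function with trace `1` on `Γ i` and `0` on the
other components (the value does not depend on the choice of that function). -/
def HasFlux (Ω : Opens E3) {L : ℕ} (Γ : Fin (L + 1) → Set E3) (v : E3 → E3) (d : E3 → ℝ)
    (i : Fin (L + 1)) (c : ℝ) : Prop :=
  ∃ χ : H1 Ω, HasBoundaryValue χ (Γ i) 1 ∧ (∀ j, j ≠ i → HasBoundaryValue χ (Γ j) 0) ∧
    normalTrace v d χ = c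

/-! ### The extended weak formulation -/

/-- A coefficient matrix: bounded measurable entries, symmetric, uniformly positive definite. -/
structure IsCoefficient (Ω : Opens E3) (ε : E3 → Matrix (Fin 3) (Fin 3) ℝ) : Prop where
  memLp_top : ∀ i j, MemLp (fun x => ε x i j) ∞ (volume.restrict (Ω : Set E3))
  isSymm : ∀ᵐ x ∂volume.restrict (Ω : Set E3), (ε x).IsSymm
  uniformlyPosDef : ∃ c : ℝ, 0 < c ∧ ∀ᵐ x ∂volume.restrict (Ω : Set E3), ∀ ξ : E3,
    c * ‖ξ‖ ^ 2 ≤ inner ℝ ξ (Matrix.toEuclideanLin (ε x) ξ)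

/-- The bilinear form `B(u,s;φ,ψ) = (u, ε∇φ + ∇×ψ) + (ψ, ε∇s)`; here `curlψ = ∇×ψ`. -/
def bilinearForm {Ω : Opens E3} (ε : E3 → Matrix (Fin 3) (Fin 3) ℝ) (u : L2Vec Ω) (s φ : H1 Ω)
    (ψ curlψ : L2Vec Ω) : ℝ :=
  (∫ x in (Ω : Set E3), inner ℝ (u x) (Matrix.toEuclideanLin (ε x) (grad φ x) + curlψ x))
    + ∫ x in (Ω : Set E3), inner ℝ (ψ x) (Matrix.toEuclideanLin (ε x) (grad s x))

/-- The linear form `F(φ,ψ) = (g,ψ) - (f,φ) + ⟨φ₁,φ⟩`. -/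
def linearForm {Ω : Opens E3} (f : E3 → ℝ) (g : L2Vec Ω) (φ₁ : DualTraceSpace Ω) (φ : H1 Ω)
    (ψ : L2Vec Ω) : ℝ :=
  (∫ x in (Ω : Set E3), inner ℝ (g x) (ψ x)) - (∫ x in (Ω : Set E3), f x * toL2 φ x)
    + φ₁ (trace Ω φ)

/-- `(u, s) ∈ [L²(Ω)]³ × H¹_{0c}(Ω)` solves the extended weak formulation. -/
def IsExtendedWeakSolution {Ω : Opens E3} {L : ℕ} (Γ : Fin (L + 1) → Set E3)
    (ε : E3 → Matrix (Fin 3) (Fin 3) ℝ) (f : E3 → ℝ) (g : L2Vec Ω) (φ₁ : DualTraceSpace Ω)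
    (u : L2Vec Ω) (s : H1 Ω) : Prop :=
  MemH10c Γ s ∧ ∀ (φ : H1 Ω) (ψ curlψ : L2Vec Ω), MemH0Curl ψ curlψ →
    bilinearForm ε u s φ ψ curlψ = linearForm f g φ₁ φ ψ

end DivCurl

end

open DivCurl

namespace DivCurl

variable {Ω : Opens E3}

/-! ### Gradients and test functions -/

/-! The multiplier `s` is removed by testing with `φ = 0` and `ψ = ∇s`. Since `s` is constant on
each boundary component, `∇s` lies in `H₀(curl)` and has zero curl (`memH0Curl_grad`), so the term
containing `u` drops out and `(∇s, ε∇s) = (g, ∇s)` remains. The right side vanishes because `g` is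
divergence-free with zero inner fluxes. Coercivity gives `∇s = 0`, and the zero boundary value on `Γ
0` together with connectedness of `Ω` gives `s = 0` (`eq_zero_of_grad_eq_zero`). Testing with `ψ =
0` then yields Green's formula for `εu`, which contains both the divergence equation and the normal
trace; testing with `φ = 0` and smooth compactly supported `ψ` yields the curl equation.

Both orthogonality relations for `∇s` come from `integral_inner_grad_eq_zero_of_memH10c`: modulo
`H¹₀`, the function `s` is a combination of functions whose boundary values are the indicators of
the `Γ i`. This rests on `mem_H10_of_hasBoundaryValue_zero`, which recovers `H¹₀` from zero boundary
values. A partition of unity isolates one component at a time, and density reduces matters to a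
smooth function tending to zero at the whole boundary; such a function is approximated by truncating
its small values (`mem_H10_of_tendsto_zero`).

For `s = 0`, extension by zero is weakly differentiable across `Γ 0`. The extension is therefore
constant near a point of `Γ 0`, and the constant is zero because exterior points are arbitrarily
close. -/

theorem gradient_mul {a b : E3 → ℝ} {x : E3} (ha : DifferentiableAt ℝ a x)
    (hb : DifferentiableAt ℝ b x) :
    gradient (fun y => a y * b y) x = a x • gradient b x + b x • gradient a x := by
  simp only [gradient, fderiv_fun_mul ha hb, map_add, map_smul]

theorem gradient_apply (a : E3 → ℝ) (x : E3) (k : Fin 3) :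
    gradient a x k = fderiv ℝ a x (EuclideanSpace.single k 1) := by
  rw [← inner_gradient_left, EuclideanSpace.inner_single_right]
  simp

theorem continuous_gradient {a : E3 → ℝ} (ha : ContDiff ℝ ∞ a) : Continuous (gradient a) :=
  (InnerProductSpace.toDual ℝ E3).symm.continuous.comp (ha.continuous_fderiv (by simp))

theorem continuousOn_gradient {a : E3 → ℝ} (ha : ContDiffOn ℝ ∞ a Ω) :
    ContinuousOn (gradient a) Ω :=
  (InnerProductSpace.toDual ℝ E3).symm.continuous.comp_continuousOn
    (ha.continuousOn_fderiv_of_isOpen Ω.isOpen (by simp))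

theorem tsupport_gradient_subset (a : E3 → ℝ) : tsupport (gradient a) ⊆ tsupport a := by
  refine closure_minimal (fun x hx => ?_) (isClosed_tsupport a)
  refine support_fderiv_subset ℝ (f := a) fun h => hx ?_
  simp [gradient, h]

theorem hasCompactSupport_gradient {a : E3 → ℝ} (ha : HasCompactSupport a) :
    HasCompactSupport (gradient a) :=
  ha.mono' ((subset_tsupport _).trans (tsupport_gradient_subset a))

theorem integral_gradient_eq_zero {a : E3 → ℝ} (ha : ContDiff ℝ ∞ a) (hc : HasCompactSupport a) :
    ∫ x, gradient a x = 0 := by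
  have hi : Integrable (gradient a) :=
    (continuous_gradient ha).integrable_of_hasCompactSupport (hasCompactSupport_gradient hc)
  refine ext_inner_right ℝ fun v => ?_
  rw [inner_zero_left, real_inner_comm, ← integral_inner hi]
  have h1 : Integrable fun x => fderiv ℝ a x v := by
    have := hi.const_inner v (𝕜 := ℝ)
    refine this.congr (.of_forall fun x => ?_)
    simp only [inner_gradient_right]; simp
  have h2 := integral_mul_fderiv_eq_neg_fderiv_mul_of_integrable (μ := (volume : Measure E3))
    (f := fun _ => (1 : ℝ)) (g := a) (v := v) (by simp) (by simpa using h1)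
    (by simpa using ha.continuous.integrable_of_hasCompactSupport hc) (by simp)
    (fun x _ => ha.differentiable (by simp) x)
  simp only [one_mul, fderiv_fun_const, Pi.zero_apply, zero_apply, zero_mul,
    integral_zero, neg_zero] at h2
  simpa [inner_gradient_right] using h2

theorem gradient_testFunction_eq_zero (η : 𝓓(Ω, ℝ)) {x : E3} (hx : x ∉ Ω) :
    gradient η x = 0 :=
  image_eq_zero_of_notMem_tsupport fun h => hx (η.tsupport_subset (tsupport_gradient_subset _ h))

theorem setIntegral_gradient_testFunction (η : 𝓓(Ω, ℝ)) :
    ∫ x in (Ω : Set E3), gradient η x = 0 := by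
  rw [setIntegral_eq_integral_of_forall_compl_eq_zero
    fun x hx => gradient_testFunction_eq_zero η hx]
  exact integral_gradient_eq_zero η.contDiff η.hasCompactSupport

/-- A smooth function on `Ω` that vanishes near `∂Ω` is a test function. -/
theorem exists_testFunction_eqOn {F : Type*} [NormedAddCommGroup F] [NormedSpace ℝ F]
    (hbdd : Bornology.IsBounded (Ω : Set E3)) {h : E3 → F}
    (hh : ContDiffOn ℝ ∞ h Ω)
    (h0 : ∀ y ∈ frontier (Ω : Set E3), ∀ᶠ x in 𝓝[(Ω : Set E3)] y, h x = 0) :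
    ∃ η : 𝓓(Ω, F), Set.EqOn η h Ω := by
  classical
  set k : E3 → F := (Ω : Set E3).indicator h with hk
  have hkΩ : Set.EqOn k h Ω := fun x hx => Set.indicator_of_mem hx h
  -- A point outside `Ω` is either a boundary point, near which `h` vanishes by `h0`, or has a
  -- neighbourhood disjoint from `Ω`.
  have hsub : tsupport k ⊆ Ω := by
    intro x hx
    by_contra hxΩ
    refine (notMem_tsupport_iff_eventuallyEq.2 ?_) hx
    by_cases hxc : x ∈ closure (Ω : Set E3)
    · have hxf : x ∈ frontier (Ω : Set E3) := by
        rw [Ω.isOpen.frontier_eq]; exact ⟨hxc, hxΩ⟩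
      filter_upwards [eventually_nhdsWithin_iff.1 (h0 x hxf)] with z hz
      by_cases hzΩ : z ∈ (Ω : Set E3)
      · rw [hkΩ hzΩ, hz hzΩ]; rfl
      · exact Set.indicator_of_notMem hzΩ h
    · filter_upwards [isClosed_closure.isOpen_compl.mem_nhds hxc] with z hz
      exact Set.indicator_of_notMem (fun hzΩ => hz (subset_closure hzΩ)) h
  have hsm : ContDiff ℝ ∞ k := by
    rw [contDiff_iff_contDiffAt]
    intro x
    by_cases hx : x ∈ (Ω : Set E3)
    · exact (hh.contDiffAt (Ω.isOpen.mem_nhds hx)).congr_of_eventuallyEq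
        (eventuallyEq_of_mem (Ω.isOpen.mem_nhds hx) hkΩ)
    · have := notMem_tsupport_iff_eventuallyEq.1 fun h => hx (hsub h)
      exact (contDiffAt_const (c := (0 : F))).congr_of_eventuallyEq this
  have hcs : HasCompactSupport k :=
    Metric.isCompact_of_isClosed_isBounded (isClosed_tsupport k) (hbdd.subset hsub)
  exact ⟨⟨k, hsm, hcs, hsub⟩, hkΩ⟩

theorem gradient_eqOn {a b : E3 → ℝ} (h : Set.EqOn a b Ω) :
    Set.EqOn (gradient a) (gradient b) Ω := fun _ hx =>
  (eventuallyEq_of_mem (Ω.isOpen.mem_nhds hx) h).gradient_eq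

theorem eventually_eq_zero_of_tsupport_subset {F : Type*} [NormedAddCommGroup F] {η : E3 → F}
    (h : tsupport η ⊆ Ω) {y : E3} (hy : y ∈ frontier (Ω : Set E3)) :
    ∀ᶠ x in 𝓝 y, η x = 0 := by
  rw [Ω.isOpen.frontier_eq] at hy
  exact notMem_tsupport_iff_eventuallyEq.1 fun h' => hy.2 (h h')

theorem testFunction_eventually_eq_zero {F : Type*} [NormedAddCommGroup F] [NormedSpace ℝ F]
    (η : 𝓓(Ω, F)) {y : E3} (hy : y ∈ frontier (Ω : Set E3)) : ∀ᶠ x in 𝓝 y, η x = 0 :=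
  eventually_eq_zero_of_tsupport_subset η.tsupport_subset hy

/-- The product of a test function and a smooth function on `Ω` is a test function. -/
theorem exists_testFunction_mul (hbdd : Bornology.IsBounded (Ω : Set E3)) {w : E3 → ℝ}
    (hw : ContDiffOn ℝ ∞ w Ω) (η : 𝓓(Ω, ℝ)) :
    ∃ θ : 𝓓(Ω, ℝ), Set.EqOn θ (fun x => w x * η x) Ω ∧
      Set.EqOn (gradient θ) (fun x => w x • gradient η x + η x • gradient w x) Ω := by
  obtain ⟨θ, hθ⟩ := exists_testFunction_eqOn hbdd (hw.mul η.contDiff.contDiffOn) fun y hy => by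
    filter_upwards [(testFunction_eventually_eq_zero η hy).filter_mono nhdsWithin_le_nhds]
      with x hx
    rw [hx, mul_zero]
  refine ⟨θ, hθ, fun x hx => ?_⟩
  rw [gradient_eqOn hθ hx]
  exact gradient_mul ((hw.contDiffAt (Ω.isOpen.mem_nhds hx)).differentiableAt (by simp))
    (η.contDiff.differentiable (by simp) x)

/-! ### Construction and uniqueness of weak gradients -/

theorem exists_H1 {a : E3 → ℝ} {b : E3 → E3} (ha : MemLp a 2 (volume.restrict (Ω : Set E3)))
    (hb : MemLp b 2 (volume.restrict (Ω : Set E3)))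
    (h : ∀ η : 𝓓(Ω, ℝ), ∫ x in (Ω : Set E3), a x • gradient η x
      = - ∫ x in (Ω : Set E3), η x • b x) :
    ∃ v : H1 Ω, toL2 v =ᵐ[volume.restrict (Ω : Set E3)] a ∧
      grad v =ᵐ[volume.restrict (Ω : Set E3)] b := by
  refine ⟨⟨WithLp.toLp 2 (ha.toLp a, hb.toLp b), fun η => ?_⟩, ha.coeFn_toLp, hb.coeFn_toLp⟩
  have h1 : ∫ x in (Ω : Set E3), (ha.toLp a) x • gradient η x
      = ∫ x in (Ω : Set E3), a x • gradient η x :=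
    integral_congr_ae (ha.coeFn_toLp.mono fun x hx => by simp only [hx])
  have h2 : ∫ x in (Ω : Set E3), η x • (hb.toLp b) x = ∫ x in (Ω : Set E3), η x • b x :=
    integral_congr_ae (hb.coeFn_toLp.mono fun x hx => by simp only [hx])
  exact h1.trans ((h η).trans (congrArg Neg.neg h2.symm))

theorem H1_integral (v : H1 Ω) (η : 𝓓(Ω, ℝ)) :
    ∫ x in (Ω : Set E3), toL2 v x • gradient η x = - ∫ x in (Ω : Set E3), η x • grad v x :=
  v.2 η

/-- The fundamental lemma of the calculus of variations. Local integrability is the right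
generality: the classical gradient of a smooth function on `Ω` is not known beforehand to be in
`L²`. -/
theorem ae_eq_of_forall_testFunction {b b' : E3 → E3}
    (hb : LocallyIntegrableOn b Ω) (hb' : LocallyIntegrableOn b' Ω)
    (h : ∀ η : 𝓓(Ω, ℝ), ∫ x in (Ω : Set E3), η x • b x = ∫ x in (Ω : Set E3), η x • b' x) :
    b =ᵐ[volume.restrict (Ω : Set E3)] b' := by
  have key : ∀ᵐ x, x ∈ (Ω : Set E3) → (b - b') x = 0 := by
    refine Ω.isOpen.ae_eq_zero_of_integral_contDiff_smul_eq_zero (hb.sub hb')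
      fun η hη hc hs => ?_
    have := h ⟨η, hη, hc, hs⟩
    have hint : ∀ c : E3 → E3, LocallyIntegrableOn c Ω →
        IntegrableOn (fun x => η x • c x) (Ω : Set E3) := fun c hcl => by
      have h1 : IntegrableOn (fun x => η x • c x) (tsupport η) :=
        (hcl.integrableOn_compact_subset hs hc).continuousOn_smul hη.continuous.continuousOn hc
      refine (integrableOn_iff_integrable_of_support_subset ?_).1 h1 |>.integrableOn
      exact (Function.support_smul_subset_left _ _).trans (subset_tsupport η)
    rw [← setIntegral_eq_integral_of_forall_compl_eq_zero (s := (Ω : Set E3)) fun x hx => by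
      rw [image_eq_zero_of_notMem_tsupport fun h' => hx (hs h'), zero_smul]]
    simp only [Pi.sub_apply, smul_sub]
    rw [integral_sub (hint b hb) (hint b' hb'), sub_eq_zero]
    exact this
  rw [EventuallyEq, ae_restrict_iff' Ω.isOpen.measurableSet]
  filter_upwards [key] with x hx hxΩ
  exact sub_eq_zero.1 (hx hxΩ)

theorem locallyIntegrableOn_of_memLp {F : Type*} [NormedAddCommGroup F] {b : E3 → F}
    (hb : MemLp b 2 (volume.restrict (Ω : Set E3))) : LocallyIntegrableOn b Ω :=
  locallyIntegrableOn_of_locallyIntegrable_restrict (hb.locallyIntegrable (by norm_num))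

theorem grad_ae_eq {v : H1 Ω} {b : E3 → E3} (hb : LocallyIntegrableOn b Ω)
    (h : ∀ η : 𝓓(Ω, ℝ), ∫ x in (Ω : Set E3), toL2 v x • gradient η x
      = - ∫ x in (Ω : Set E3), η x • b x) :
    grad v =ᵐ[volume.restrict (Ω : Set E3)] b :=
  ae_eq_of_forall_testFunction (locallyIntegrableOn_of_memLp (Lp.memLp _)) hb fun η =>
    neg_injective ((H1_integral v η).symm.trans (h η))

/-- Weak gradients are unique, so the first component of the pair determines the second. -/
theorem H1_ext {v w : H1 Ω} (h : toL2 v = toL2 w) : v = w := by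
  have hg : grad v = grad w := Lp.ext <| grad_ae_eq (locallyIntegrableOn_of_memLp (Lp.memLp _))
    fun η => by rw [h]; exact H1_integral w η
  exact Subtype.ext (WithLp.ofLp_injective 2 (Prod.ext h hg))

/-- The weak gradient of a smooth function is the classical one. -/
theorem integral_smul_gradient (hbdd : Bornology.IsBounded (Ω : Set E3)) {w : E3 → ℝ}
    (hw : ContDiffOn ℝ ∞ w Ω) (η : 𝓓(Ω, ℝ)) :
    ∫ x in (Ω : Set E3), w x • gradient η x = - ∫ x in (Ω : Set E3), η x • gradient w x := by
  -- The gradient of `θ = wη` has integral zero, and the product rule splits it into the two sides.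
  -- As `w` may be unbounded near `∂Ω`, integrability comes from the compact support of `η`.
  obtain ⟨θ, -, hθ⟩ := exists_testFunction_mul hbdd hw η
  have hint : ∀ {c : E3 → E3}, ContinuousOn c Ω → tsupport c ⊆ tsupport η →
      IntegrableOn c (Ω : Set E3) := fun {c} hc hs => by
    have h1 : IntegrableOn c (tsupport η) :=
      (hc.mono η.tsupport_subset).integrableOn_compact η.hasCompactSupport
    exact ((integrableOn_iff_integrable_of_support_subset
      ((subset_tsupport c).trans hs)).1 h1).integrableOn
  have hi1 : IntegrableOn (fun x => w x • gradient η x) (Ω : Set E3) :=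
    hint (hw.continuousOn.smul (continuous_gradient η.contDiff).continuousOn)
      ((tsupport_smul_subset_right w (gradient η)).trans (tsupport_gradient_subset _))
  have hi2 : IntegrableOn (fun x => η x • gradient w x) (Ω : Set E3) :=
    hint (η.continuous.continuousOn.smul (continuousOn_gradient hw))
      (tsupport_smul_subset_left (⇑η) (gradient w))
  rw [eq_neg_iff_add_eq_zero, ← integral_add hi1 hi2, ← setIntegral_gradient_testFunction θ]
  exact setIntegral_congr_fun Ω.isOpen.measurableSet fun x hx => (hθ hx).symm

theorem grad_ae_eq_gradient (hbdd : Bornology.IsBounded (Ω : Set E3)) {v : H1 Ω} {w : E3 → ℝ}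
    (hw : ContDiffOn ℝ ∞ w Ω) (hv : toL2 v =ᵐ[volume.restrict (Ω : Set E3)] w) :
    grad v =ᵐ[volume.restrict (Ω : Set E3)] gradient w := by
  refine grad_ae_eq ((continuousOn_gradient hw).locallyIntegrableOn Ω.isOpen.measurableSet)
    fun η => ?_
  rw [← integral_smul_gradient hbdd hw η]
  exact integral_congr_ae (hv.mono fun x hx => by simp only [hx])

theorem exists_bound_of_continuous (hbdd : Bornology.IsBounded (Ω : Set E3)) {F : Type*}
    [NormedAddCommGroup F] {a : E3 → F} (ha : Continuous a) :
    ∃ C : ℝ, 0 ≤ C ∧ ∀ᵐ x ∂volume.restrict (Ω : Set E3), ‖a x‖ ≤ C := by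
  obtain ⟨C, hC⟩ := hbdd.isCompact_closure.exists_bound_of_continuousOn ha.continuousOn
  refine ⟨max C 0, le_max_right _ _, ?_⟩
  filter_upwards [ae_restrict_mem Ω.isOpen.measurableSet] with x hx
  exact (hC x (subset_closure hx)).trans (le_max_left _ _)

theorem memLp_of_continuous (hbdd : Bornology.IsBounded (Ω : Set E3)) {F : Type*}
    [NormedAddCommGroup F] {a : E3 → F} (ha : Continuous a) [SecondCountableTopology F] :
    MemLp a 2 (volume.restrict (Ω : Set E3)) := by
  obtain ⟨C, -, hC⟩ := exists_bound_of_continuous hbdd ha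
  have : IsFiniteMeasure (volume.restrict (Ω : Set E3)) :=
    ⟨by rw [Measure.restrict_apply_univ]; exact hbdd.measure_lt_top⟩
  exact MemLp.of_bound ha.aestronglyMeasurable C hC

theorem exists_H1_of_contDiff (hbdd : Bornology.IsBounded (Ω : Set E3)) {w : E3 → ℝ}
    (hw : ContDiff ℝ ∞ w) :
    ∃ v : H1 Ω, toL2 v =ᵐ[volume.restrict (Ω : Set E3)] w ∧
      grad v =ᵐ[volume.restrict (Ω : Set E3)] gradient w :=
  exists_H1 (memLp_of_continuous hbdd hw.continuous)
    (memLp_of_continuous hbdd (continuous_gradient hw))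
    fun η => integral_smul_gradient hbdd hw.contDiffOn η

/-! ### Convergence in `H¹` and multiplication by smooth functions -/

theorem tendsto_Lp_of_dominated {F : Type*} [NormedAddCommGroup F] [InnerProductSpace ℝ F]
    {μ : Measure E3} {f : ℕ → Lp F 2 μ} {f₀ : Lp F 2 μ} {b : E3 → ℝ} (hb : MemLp b 2 μ)
    (hbound : ∀ n, ∀ᵐ x ∂μ, ‖f n x - f₀ x‖ ≤ b x)
    (hlim : ∀ᵐ x ∂μ, Tendsto (fun n => f n x) atTop (𝓝 (f₀ x))) :
    Tendsto f atTop (𝓝 f₀) := by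
  rw [tendsto_iff_norm_sub_tendsto_zero]
  have hsq : ∀ n, ‖f n - f₀‖ ^ 2 = ∫ x, ‖f n x - f₀ x‖ ^ 2 ∂μ := fun n => by
    rw [← real_inner_self_eq_norm_sq, L2.inner_def]
    refine integral_congr_ae ?_
    filter_upwards [Lp.coeFn_sub (f n) f₀] with x hx
    rw [hx, real_inner_self_eq_norm_sq, Pi.sub_apply]
  have hlim2 : Tendsto (fun n => ∫ x, ‖f n x - f₀ x‖ ^ 2 ∂μ) atTop (𝓝 (∫ _, (0 : ℝ) ∂μ)) := by
    refine tendsto_integral_of_dominated_convergence (fun x => b x ^ 2)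
      (fun n => (((Lp.aestronglyMeasurable _).sub (Lp.aestronglyMeasurable _)).norm.pow 2))
      hb.integrable_sq (fun n => ?_) ?_
    · filter_upwards [hbound n] with x hx
      rw [Real.norm_of_nonneg (by positivity)]
      gcongr
    · filter_upwards [hlim] with x hx
      simpa using ((tendsto_iff_norm_sub_tendsto_zero.1 hx).pow 2)
  rw [integral_zero] at hlim2
  simp_rw [← hsq] at hlim2
  simpa [Real.sqrt_sq (norm_nonneg _)] using hlim2.sqrt

theorem continuous_toL2 : Continuous (toL2 : H1 Ω → L2 Ω) :=
  (WithLp.prod_continuous_ofLp 2 _ _).fst.comp continuous_subtype_val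

theorem continuous_grad : Continuous (grad : H1 Ω → L2Vec Ω) :=
  (WithLp.prod_continuous_ofLp 2 _ _).snd.comp continuous_subtype_val

theorem tendsto_H1 {ι : Type*} {l : Filter ι} {v : ι → H1 Ω} {v₀ : H1 Ω}
    (h1 : Tendsto (fun i => toL2 (v i)) l (𝓝 (toL2 v₀)))
    (h2 : Tendsto (fun i => grad (v i)) l (𝓝 (grad v₀))) : Tendsto v l (𝓝 v₀) := by
  rw [tendsto_subtype_rng]
  exact ((WithLp.prod_continuous_toLp 2 _ _).tendsto _).comp (h1.prodMk_nhds h2)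

/-- Covers the three products `ζφ`, `ζ∇φ` and `φ∇ζ` of the product rule at once; the map is
Lipschitz with constant `‖B‖ * C`. -/
theorem exists_continuous_bilinear {F G H : Type*} [NormedAddCommGroup F] [NormedSpace ℝ F]
    [NormedAddCommGroup G] [NormedSpace ℝ G] [NormedAddCommGroup H] [NormedSpace ℝ H]
    {μ : Measure E3} (B : F →L[ℝ] G →L[ℝ] H) {m : E3 → F} (hm : AEStronglyMeasurable m μ)
    {C : ℝ} (hC : ∀ᵐ x ∂μ, ‖m x‖ ≤ C) :
    ∃ T : Lp G 2 μ → Lp H 2 μ, Continuous T ∧ ∀ f, T f =ᵐ[μ] fun x => B (m x) (f x) := by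
  have hle : ∀ᵐ x ∂μ, ∀ z : G, ‖B (m x) z‖ ≤ (‖B‖ * C) * ‖z‖ := by
    filter_upwards [hC] with x hx z
    exact (B.le_opNorm₂ _ _).trans (by gcongr)
  have hmem : ∀ f : Lp G 2 μ, MemLp (fun x => B (m x) (f x)) 2 μ := fun f =>
    (Lp.memLp f).of_le_mul (B.aestronglyMeasurable_comp₂ hm (Lp.aestronglyMeasurable f))
      (hle.mono fun x hx => hx _)
  refine ⟨fun f => (hmem f).toLp _, ?_, fun f => (hmem f).coeFn_toLp⟩
  refine (LipschitzWith.of_dist_le_mul (K := Real.toNNReal (‖B‖ * C)) fun f g => ?_).continuous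
  rw [dist_eq_norm, dist_eq_norm]
  refine Lp.norm_le_mul_norm_of_ae_le_mul ?_
  filter_upwards [hle, Lp.coeFn_sub ((hmem f).toLp _) ((hmem g).toLp _), Lp.coeFn_sub f g,
    (hmem f).coeFn_toLp, (hmem g).coeFn_toLp] with x h1 h2 h3 h4 h5
  rw [h2, h3, Pi.sub_apply, Pi.sub_apply, h4, h5, ← map_sub]
  exact (h1 _).trans (by gcongr; exact Real.le_coe_toNNReal _)

/-- Multiplication by a smooth function is continuous on `H¹(Ω)`. -/
theorem exists_continuous_mul (hbdd : Bornology.IsBounded (Ω : Set E3)) {ζ : E3 → ℝ}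
    (hζ : ContDiff ℝ ∞ ζ) :
    ∃ M : H1 Ω → H1 Ω, Continuous M ∧ ∀ v,
      toL2 (M v) =ᵐ[volume.restrict (Ω : Set E3)] (fun x => ζ x * toL2 v x) ∧
      grad (M v) =ᵐ[volume.restrict (Ω : Set E3)]
        fun x => ζ x • grad v x + toL2 v x • gradient ζ x := by
  have hgc := continuous_gradient hζ
  obtain ⟨C, -, hC⟩ := exists_bound_of_continuous hbdd hζ.continuous
  obtain ⟨C', -, hC'⟩ := exists_bound_of_continuous hbdd hgc
  obtain ⟨T, hTc, hT⟩ := exists_continuous_bilinear (ContinuousLinearMap.mul ℝ ℝ)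
    hζ.continuous.aestronglyMeasurable hC
  obtain ⟨S, hSc, hS⟩ := exists_continuous_bilinear (ContinuousLinearMap.lsmul ℝ ℝ (E := E3))
    hζ.continuous.aestronglyMeasurable hC
  obtain ⟨R, hRc, hR⟩ := exists_continuous_bilinear
    (ContinuousLinearMap.lsmul ℝ ℝ (E := E3)).flip hgc.aestronglyMeasurable hC'
  have hSR : ∀ v : H1 Ω, (S (grad v) + R (toL2 v) : L2Vec Ω)
      =ᵐ[volume.restrict (Ω : Set E3)] fun x => ζ x • grad v x + toL2 v x • gradient ζ x := by
    intro v
    filter_upwards [Lp.coeFn_add (S (grad v)) (R (toL2 v)), hS (grad v), hR (toL2 v)]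
      with x h1 h2 h3
    rw [h1, Pi.add_apply, h2, h3]
    rfl
  have hmem : ∀ v : H1 Ω, WithLp.toLp 2 (T (toL2 v), S (grad v) + R (toL2 v)) ∈ H1 Ω := by
    intro v η
    -- The weak product rule: test `v` against `θ = ζη`, and let the term `v η ∇ζ` change sides.
    obtain ⟨θ, hθ, hθ'⟩ := exists_testFunction_mul hbdd hζ.contDiffOn η
    have hR2 : IntegrableOn (fun x => toL2 v x • (η x • gradient ζ x)) (Ω : Set E3) :=
      integrable_smul_of_memLp (Lp.memLp _)
        (memLp_of_continuous hbdd (η.continuous.smul hgc))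
    have e1 : ∫ x in (Ω : Set E3), T (toL2 v) x • gradient η x
        = (∫ x in (Ω : Set E3), toL2 v x • gradient θ x)
          - ∫ x in (Ω : Set E3), toL2 v x • (η x • gradient ζ x) := by
      rw [← integral_sub (integrable_smul_of_memLp (Lp.memLp _) (memLp_gradient_test θ)) hR2]
      refine integral_congr_ae ?_
      filter_upwards [hT (toL2 v), ae_restrict_mem Ω.isOpen.measurableSet] with x h1 hx
      rw [h1, hθ' hx, ContinuousLinearMap.mul_apply']
      module
    have e2 : ∫ x in (Ω : Set E3), η x • (S (grad v) + R (toL2 v) : L2Vec Ω) x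
        = (∫ x in (Ω : Set E3), θ x • grad v x)
          + ∫ x in (Ω : Set E3), toL2 v x • (η x • gradient ζ x) := by
      rw [← integral_add (integrable_smul_of_memLp (memLp_test θ) (Lp.memLp _)) hR2]
      refine integral_congr_ae ?_
      filter_upwards [hSR v, ae_restrict_mem Ω.isOpen.measurableSet] with x h1 hx
      rw [h1, hθ hx]
      module
    refine e1.trans (Eq.trans ?_ (congrArg Neg.neg e2.symm))
    rw [H1_integral v θ]
    abel
  refine ⟨fun v => ⟨_, hmem v⟩, ?_, fun v => ⟨hT (toL2 v), hSR v⟩⟩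
  exact Continuous.subtype_mk ((WithLp.prod_continuous_toLp 2 _ _).comp
    ((hTc.comp continuous_toL2).prodMk
      ((hSc.comp continuous_grad).add (hRc.comp continuous_toL2)))) _

/-! ### Functions with vanishing boundary values -/

/-- A smooth function that vanishes near `0` and is the identity away from `0`. -/
noncomputable def shrink (t : ℝ) : ℝ := t * Real.smoothTransition (t ^ 2 - 1)

theorem contDiff_shrink : ContDiff ℝ ∞ shrink :=
  contDiff_id.mul (Real.smoothTransition.contDiff.comp ((contDiff_id.pow 2).sub contDiff_const))

theorem abs_shrink_le (t : ℝ) : |shrink t| ≤ |t| := by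
  rw [shrink, abs_mul, abs_of_nonneg (Real.smoothTransition.nonneg _)]
  exact mul_le_of_le_one_right (abs_nonneg t) (Real.smoothTransition.le_one _)

theorem shrink_eq_zero {t : ℝ} (h : t ^ 2 ≤ 1) : shrink t = 0 := by
  rw [shrink, Real.smoothTransition.zero_of_nonpos (by linarith), mul_zero]

theorem shrink_eq_self {t : ℝ} (h : 2 ≤ t ^ 2) : shrink t = t := by
  rw [shrink, Real.smoothTransition.one_of_one_le (by linarith), mul_one]

theorem deriv_shrink_zero : deriv shrink 0 = 0 := by
  have : shrink =ᶠ[𝓝 0] fun _ => (0 : ℝ) := by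
    have hc : ContinuousAt (fun t : ℝ => t ^ 2) 0 := by fun_prop
    filter_upwards [hc.eventually_lt_const (u := 1) (by norm_num)] with t ht
    exact shrink_eq_zero ht.le
  rw [this.deriv_eq, deriv_const]

theorem deriv_shrink_eq_one {t : ℝ} (h : 2 < t ^ 2) : deriv shrink t = 1 := by
  have : shrink =ᶠ[𝓝 t] id := by
    have hc : ContinuousAt (fun t : ℝ => t ^ 2) t := by fun_prop
    filter_upwards [hc.eventually_const_lt h] with s hs
    exact shrink_eq_self hs.le
  rw [this.deriv_eq, deriv_id]

/-- Where `t² > 2` the derivative is `1`; the remaining `t` lie in the compact interval `[-2, 2]`.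
-/
theorem exists_abs_deriv_shrink_le : ∃ C : ℝ, 0 ≤ C ∧ ∀ t, |deriv shrink t| ≤ C := by
  obtain ⟨C, hC⟩ := (isCompact_Icc (a := (-2 : ℝ)) (b := 2)).exists_bound_of_continuousOn
    (contDiff_shrink.continuous_deriv (by simp)).continuousOn
  refine ⟨max C 1, by positivity, fun t => ?_⟩
  by_cases ht : 2 < t ^ 2
  · rw [deriv_shrink_eq_one ht, abs_one]; exact le_max_right _ _
  · exact (hC t ⟨by nlinarith, by nlinarith⟩).trans (le_max_left _ _)

/-- The rescaled truncation kills values with `|t| ≤ 1/(n+1)` and keeps those with `|t| ≥ √2/(n+1)`.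
At `t = 0` the derivatives tend to `0` and not to `1`; `mem_H10_of_tendsto_zero` has to account for
this. -/
theorem tendsto_shrink (t : ℝ) :
    Tendsto (fun n : ℕ => shrink ((n + 1) * t) / (n + 1)) atTop (𝓝 t) ∧
    Tendsto (fun n : ℕ => deriv shrink ((n + 1) * t)) atTop (𝓝 (if t = 0 then 0 else 1)) := by
  by_cases ht : t = 0
  · subst ht
    simp [shrink, deriv_shrink_zero]
  · have hev : ∀ᶠ n : ℕ in atTop, 2 < (((n : ℝ) + 1) * t) ^ 2 := by
      have h1 : Tendsto (fun n : ℕ => ((n : ℝ) + 1) * |t|) atTop atTop :=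
        (tendsto_atTop_add_const_right _ _ tendsto_natCast_atTop_atTop).atTop_mul_const
          (abs_pos.2 ht)
      filter_upwards [h1.eventually_gt_atTop 2] with n hn
      have : (((n : ℝ) + 1) * t) ^ 2 = (((n : ℝ) + 1) * |t|) ^ 2 := by
        rw [mul_pow, mul_pow, sq_abs]
      rw [this]; nlinarith
    refine ⟨tendsto_const_nhds.congr' ?_, tendsto_const_nhds.congr' ?_⟩
    · filter_upwards [hev] with n hn
      rw [shrink_eq_self hn.le]
      field_simp
    · filter_upwards [hev] with n hn
      rw [deriv_shrink_eq_one hn, if_neg ht]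

theorem gradient_comp_real {G : ℝ → ℝ} {w : E3 → ℝ} {x : E3} (hG : DifferentiableAt ℝ G (w x))
    (hw : DifferentiableAt ℝ w x) :
    gradient (fun y => G (w y)) x = deriv G (w x) • gradient w x := by
  have h : fderiv ℝ (fun y => G (w y)) x = deriv G (w x) • fderiv ℝ w x :=
    (hG.hasDerivAt.comp_hasFDerivAt x hw.hasFDerivAt).fderiv
  simp only [gradient, h, map_smul]

/-- A function in `H¹(Ω)` that is smooth in `Ω` and tends to zero at `∂Ω` belongs to `H¹₀(Ω)`. -/
theorem mem_H10_of_tendsto_zero (hbdd : Bornology.IsBounded (Ω : Set E3)) {v : H1 Ω}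
    {w : E3 → ℝ} (hw : ContDiffOn ℝ ∞ w Ω) (hv : toL2 v =ᵐ[volume.restrict (Ω : Set E3)] w)
    (h0 : ∀ y ∈ frontier (Ω : Set E3), Tendsto w (𝓝[(Ω : Set E3)] y) (𝓝 0)) :
    v ∈ H10 Ω := by
  have hgrad := grad_ae_eq_gradient hbdd hw hv
  obtain ⟨C, hC0, hC⟩ := exists_abs_deriv_shrink_le
  -- Near each boundary point `|(n+1)w| < 1`, so the truncated function vanishes there and is a test
  -- function.
  have hη : ∀ n : ℕ, ∃ η : 𝓓(Ω, ℝ), Set.EqOn η (fun x => shrink ((n + 1) * w x) / (n + 1)) Ω := by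
    intro n
    refine exists_testFunction_eqOn hbdd
      ((contDiff_shrink.comp_contDiffOn (contDiffOn_const.mul hw)).div_const _) fun y hy => ?_
    have h1 : Tendsto (fun x => (((n : ℝ) + 1) * w x) ^ 2) (𝓝[(Ω : Set E3)] y) (𝓝 0) := by
      simpa using (((h0 y hy).const_mul ((n : ℝ) + 1)).pow 2)
    filter_upwards [h1.eventually_lt_const (u := 1) one_pos] with x hx
    rw [shrink_eq_zero hx.le, zero_div]
  choose η hη using hη
  have hηg : ∀ n, Set.EqOn (gradient (η n))
      (fun x => deriv shrink ((n + 1) * w x) • gradient w x) Ω := by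
    intro n x hx
    have hwx := (hw.contDiffAt (Ω.isOpen.mem_nhds hx)).differentiableAt (by simp)
    have hsd : Differentiable ℝ shrink := contDiff_shrink.differentiable (by simp)
    rw [gradient_eqOn (hη n) hx,
      gradient_comp_real (G := fun t => shrink (((n : ℝ) + 1) * t) / (n + 1)) (by fun_prop) hwx]
    congr 1
    have h1 : HasDerivAt (fun t => shrink (((n : ℝ) + 1) * t) / (n + 1))
        (deriv shrink (((n : ℝ) + 1) * w x) * (((n : ℝ) + 1) * 1) / (n + 1)) (w x) :=
      ((hsd _).hasDerivAt.comp (w x) ((hasDerivAt_id (w x)).const_mul ((n : ℝ) + 1))).div_const _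
    rw [h1.deriv]
    field_simp
  choose V hV hVg using fun n => exists_H1_of_contDiff (Ω := Ω) hbdd (η n).contDiff
  have hV' : ∀ n, toL2 (V n) =ᵐ[volume.restrict (Ω : Set E3)]
      fun x => shrink ((n + 1) * toL2 v x) / (n + 1) := fun n => by
    filter_upwards [hV n, hv, ae_restrict_mem Ω.isOpen.measurableSet] with x h1 h2 hx
    rw [h1, hη n hx, h2]
  have hVg' : ∀ n, grad (V n) =ᵐ[volume.restrict (Ω : Set E3)]
      fun x => deriv shrink ((n + 1) * toL2 v x) • grad v x := fun n => by
    filter_upwards [hVg n, hv, hgrad, ae_restrict_mem Ω.isOpen.measurableSet] with x h1 h2 h3 hx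
    rw [h1, hηg n hx, h2, h3]
  have hbV : ∀ n, ∀ᵐ x ∂volume.restrict (Ω : Set E3), ‖toL2 (V n) x‖ ≤ ‖toL2 v x‖ := fun n => by
    filter_upwards [hV' n] with x hx
    have hn : (0 : ℝ) < n + 1 := by positivity
    rw [hx, norm_div, Real.norm_of_nonneg hn.le, div_le_iff₀ hn]
    refine (abs_shrink_le _).trans ?_
    rw [abs_mul, abs_of_pos hn, mul_comm]
    rfl
  have hbVg : ∀ n, ∀ᵐ x ∂volume.restrict (Ω : Set E3), ‖grad (V n) x‖ ≤ C * ‖grad v x‖ :=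
    fun n => by
      filter_upwards [hVg' n] with x hx
      rw [hx, norm_smul]
      gcongr
      exact hC _
  have hlV : ∀ᵐ x ∂volume.restrict (Ω : Set E3),
      Tendsto (fun n => toL2 (V n) x) atTop (𝓝 (toL2 v x)) := by
    filter_upwards [ae_all_iff.2 hV'] with x hx
    simp_rw [hx]
    exact (tendsto_shrink _).1
  have hlVg : ∀ᵐ x ∂volume.restrict (Ω : Set E3),
      Tendsto (fun n => grad (V n) x) atTop
        (𝓝 ({x | toL2 v x ≠ 0}.indicator (grad v) x)) := by
    filter_upwards [ae_all_iff.2 hVg'] with x hx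
    simp_rw [hx]
    have := (tendsto_shrink (toL2 v x)).2.smul_const (grad v x)
    by_cases hz : toL2 v x = 0
    · simpa [hz] using this
    · simpa [hz] using this
  have hmeas : MeasurableSet {x | toL2 v x ≠ 0} :=
    (Lp.stronglyMeasurable (toL2 v)).measurable (measurableSet_singleton 0).compl
  -- Passing to the limit in the weak gradient identity for `V n` shows that the truncated gradient
  -- is also a weak gradient of `v`. By uniqueness `∇v = 0` a.e. on `{v = 0}`, so the gradients of
  -- `V n` do converge to `∇v`.
  have hq : grad v =ᵐ[volume.restrict (Ω : Set E3)] {x | toL2 v x ≠ 0}.indicator (grad v) := by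
    refine grad_ae_eq (locallyIntegrableOn_of_memLp ((Lp.memLp (grad v)).indicator hmeas))
      fun θ => ?_
    have l1 : Tendsto (fun n => ∫ x in (Ω : Set E3), toL2 (V n) x • gradient θ x) atTop
        (𝓝 (∫ x in (Ω : Set E3), toL2 v x • gradient θ x)) := by
      refine tendsto_integral_of_dominated_convergence (fun x => ‖toL2 v x • gradient θ x‖)
        (fun n => (integrable_smul_of_memLp (Lp.memLp _)
          (memLp_gradient_test θ)).aestronglyMeasurable)
        (integrable_smul_of_memLp (Lp.memLp _) (memLp_gradient_test θ)).norm (fun n => ?_) ?_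
      · filter_upwards [hbV n] with x hx
        rw [norm_smul, norm_smul]
        gcongr
      · filter_upwards [hlV] with x hx
        exact hx.smul_const _
    have l2 : Tendsto (fun n => ∫ x in (Ω : Set E3), θ x • grad (V n) x) atTop
        (𝓝 (∫ x in (Ω : Set E3), θ x • {x | toL2 v x ≠ 0}.indicator (grad v) x)) := by
      refine tendsto_integral_of_dominated_convergence (fun x => C * ‖θ x • grad v x‖)
        (fun n => (integrable_smul_of_memLp (memLp_test θ) (Lp.memLp _)).aestronglyMeasurable)
        ((integrable_smul_of_memLp (memLp_test θ) (Lp.memLp _)).norm.const_mul C)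
        (fun n => ?_) ?_
      · filter_upwards [hbVg n] with x hx
        rw [norm_smul, norm_smul, mul_left_comm]
        gcongr
      · filter_upwards [hlVg] with x hx
        exact hx.const_smul _
    refine tendsto_nhds_unique l1 ?_
    simp_rw [H1_integral]
    exact l2.neg
  have hlim : Tendsto V atTop (𝓝 v) := by
    refine tendsto_H1 (tendsto_Lp_of_dominated ((Lp.memLp (toL2 v)).norm.const_mul 2)
      (fun n => ?_) hlV) (tendsto_Lp_of_dominated
        ((Lp.memLp (grad v)).norm.const_mul (C + 1)) (fun n => ?_) ?_)
    · filter_upwards [hbV n] with x hx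
      refine (norm_sub_le _ _).trans ?_
      linarith
    · filter_upwards [hbVg n] with x hx
      refine (norm_sub_le _ _).trans ?_
      linarith
    · filter_upwards [hlVg, hq] with x h1 h2
      rwa [← h2] at h1
  exact mem_closure_of_tendsto hlim (.of_forall fun n => ⟨η n, hV n⟩)

/-! ### Boundary values -/

/-- The inclusion `H¹(Ω) → L²(Ω)` as a linear map. -/
def toL2Linear (Ω : Opens E3) : H1 Ω →ₗ[ℝ] L2 Ω where
  toFun := toL2
  map_add' _ _ := rfl
  map_smul' _ _ := rfl

/-- The weak gradient as a linear map. -/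
def gradLinear (Ω : Opens E3) : H1 Ω →ₗ[ℝ] L2Vec Ω where
  toFun := grad
  map_add' _ _ := rfl
  map_smul' _ _ := rfl

theorem hasBoundaryValue_zero (S : Set E3) : HasBoundaryValue (0 : H1 Ω) S 0 :=
  subset_closure ⟨fun _ => 0, contDiffOn_const,
    Lp.coeFn_zero ℝ 2 (volume.restrict (Ω : Set E3)), fun _ _ => tendsto_const_nhds⟩

theorem HasBoundaryValue.add {v w : H1 Ω} {S : Set E3} {α β : ℝ} (hv : HasBoundaryValue v S α)
    (hw : HasBoundaryValue w S β) : HasBoundaryValue (v + w) S (α + β) := by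
  refine map_mem_closure₂ continuous_add hv hw ?_
  rintro v ⟨a, ha, hva, hal⟩ w ⟨b, hb, hwb, hbl⟩
  refine ⟨fun x => a x + b x, ha.add hb, ?_, fun y hy => (hal y hy).add (hbl y hy)⟩
  filter_upwards [Lp.coeFn_add (toL2 v) (toL2 w), hva, hwb] with x h1 h2 h3
  exact h1.trans (by rw [Pi.add_apply, h2, h3])

theorem HasBoundaryValue.smul {v : H1 Ω} {S : Set E3} {α : ℝ} (c : ℝ)
    (hv : HasBoundaryValue v S α) : HasBoundaryValue (c • v) S (c * α) := by
  refine map_mem_closure (continuous_const_smul c) hv ?_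
  rintro v ⟨a, ha, hva, hal⟩
  refine ⟨fun x => c * a x, contDiffOn_const.mul ha, ?_, fun y hy => (hal y hy).const_mul c⟩
  filter_upwards [Lp.coeFn_smul c (toL2 v), hva] with x h1 h2
  exact h1.trans (by rw [Pi.smul_apply, h2, smul_eq_mul])

theorem HasBoundaryValue.sum {ι : Type*} {S : Set E3} (s : Finset ι) {v : ι → H1 Ω} {α : ι → ℝ}
    (h : ∀ i ∈ s, HasBoundaryValue (v i) S (α i)) :
    HasBoundaryValue (∑ i ∈ s, v i) S (∑ i ∈ s, α i) := by
  classical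
  induction s using Finset.induction_on with
  | empty => simpa using hasBoundaryValue_zero S
  | insert i s hi ih =>
    rw [Finset.sum_insert hi, Finset.sum_insert hi]
    exact (h i (Finset.mem_insert_self i s)).add
      (ih fun j hj => h j (Finset.mem_insert_of_mem hj))

/-- Cutting off a function with boundary value `0` on `S` away from `∂Ω \ S` gives a function
in `H¹₀(Ω)`. -/
theorem mul_mem_H10 (hbdd : Bornology.IsBounded (Ω : Set E3)) {ζ : E3 → ℝ}
    (hζ : ContDiff ℝ ∞ ζ) {M : H1 Ω → H1 Ω} (hM : Continuous M)
    (hMζ : ∀ v, toL2 (M v) =ᵐ[volume.restrict (Ω : Set E3)] fun x => ζ x * toL2 v x)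
    {S : Set E3} (hS : ∀ y ∈ frontier (Ω : Set E3), y ∈ S ∨ ∀ᶠ x in 𝓝 y, ζ x = 0)
    {φ : H1 Ω} (hφ : HasBoundaryValue φ S 0) : M φ ∈ H10 Ω := by
  have hcl : closure (H10 Ω : Set (H1 Ω)) = H10 Ω :=
    ((testH1 Ω).isClosed_topologicalClosure).closure_eq
  -- `H¹₀` is closed and `M` continuous, so `φ` may be replaced by a smooth approximant `w`. Then
  -- `ζw` tends to zero at all of `∂Ω`: on `S` because `w` does, elsewhere because `ζ` vanishes.
  suffices h : M φ ∈ closure (H10 Ω : Set (H1 Ω)) by rwa [hcl] at h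
  refine map_mem_closure hM hφ ?_
  rintro v ⟨w, hw, hvw, hwl⟩
  refine mem_H10_of_tendsto_zero hbdd (hζ.contDiffOn.mul hw) ?_ fun y hy => ?_
  · filter_upwards [hMζ v, hvw] with x h1 h2
    rw [h1, h2]
  · rcases hS y hy with hyS | hy0
    · simpa using ((hζ.continuous.tendsto y).mono_left nhdsWithin_le_nhds).mul (hwl y hyS)
    · refine tendsto_const_nhds.congr' ?_
      filter_upwards [hy0.filter_mono nhdsWithin_le_nhds] with x hx
      rw [hx, zero_mul]

theorem exists_smooth_separation {A B : Set E3} (hA : IsClosed A) (hB : IsClosed B)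
    (hAB : Disjoint A B) :
    ∃ ζ : E3 → ℝ, ContDiff ℝ ∞ ζ ∧ (∀ y ∈ A, ∀ᶠ x in 𝓝 y, ζ x = 0) ∧
      ∀ y ∈ B, ∀ᶠ x in 𝓝 y, ζ x = 1 := by
  obtain ⟨ζ, h0, h1, -⟩ := exists_contMDiffMap_zero_one_nhds_of_isClosed (n := ⊤)
    (modelWithCornersSelf ℝ E3) hA hB hAB
  exact ⟨ζ, ζ.contMDiff.contDiff, eventually_nhdsSet_iff_forall.1 h0,
    eventually_nhdsSet_iff_forall.1 h1⟩

/-- A smooth partition of unity subordinate to the components of the boundary. -/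
theorem exists_boundary_cutoffs {L : ℕ} {Γ : Fin (L + 1) → Set E3}
    (hcl : ∀ i, IsClosed (Γ i)) (hdisj : ∀ i j, i ≠ j → Disjoint (Γ i) (Γ j)) :
    ∃ ζ : Fin (L + 1) → E3 → ℝ, (∀ i, ContDiff ℝ ∞ (ζ i)) ∧ (∀ x, ∑ i, ζ i x = 1) ∧
      ∀ i j, ∀ y ∈ Γ j, ∀ᶠ x in 𝓝 y, ζ i x = if j = i then 1 else 0 := by
  have hex : ∀ i : Fin L, ∃ ζ : E3 → ℝ, ContDiff ℝ ∞ ζ ∧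
      ∀ j, ∀ y ∈ Γ j, ∀ᶠ x in 𝓝 y, ζ x = if j = i.succ then 1 else 0 := by
    intro i
    have hA : IsClosed (⋃ j ∈ {j | j ≠ i.succ}, Γ j) :=
      (Set.toFinite {j | j ≠ i.succ}).isClosed_biUnion fun j _ => hcl j
    obtain ⟨ζ, hζ, h0, h1⟩ := exists_smooth_separation hA (hcl i.succ)
      (Set.disjoint_iUnion₂_left.2 fun j hj => hdisj j _ hj)
    refine ⟨ζ, hζ, fun j y hy => ?_⟩
    by_cases hj : j = i.succ
    · subst hj
      simpa using h1 y hy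
    · simpa [hj] using h0 y (Set.mem_biUnion hj hy)
  choose ζ hζ hζΓ using hex
  -- Index `0` receives the complement, so the sum is `1` everywhere and not only near the boundary.
  refine ⟨Fin.cons (fun x => 1 - ∑ i, ζ i x) ζ, ?_, fun x => ?_, ?_⟩
  · refine Fin.cases ?_ fun i => ?_
    · exact contDiff_const.sub (ContDiff.sum fun i _ => hζ i)
    · exact hζ i
  · simp [Fin.sum_univ_succ]
  · refine Fin.cases (fun j y hy => ?_) fun i j y hy => ?_
    · filter_upwards [eventually_all.2 fun i => hζΓ i j y hy] with x hx
      simp only [Fin.cons_zero, hx]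
      refine Fin.cases ?_ (fun k => ?_) j
      · simp [(Fin.succ_ne_zero _).symm]
      · simp [Fin.succ_ne_zero]
    · exact hζΓ i j y hy

/-- A function with boundary value `0` on every component of the boundary is in `H¹₀(Ω)`. -/
theorem mem_H10_of_hasBoundaryValue_zero (hbdd : Bornology.IsBounded (Ω : Set E3)) {L : ℕ}
    {Γ : Fin (L + 1) → Set E3} (hΓ : IsBoundaryDecomposition (Ω : Set E3) L Γ) {φ : H1 Ω}
    (hφ : ∀ i, HasBoundaryValue φ (Γ i) 0) : φ ∈ H10 Ω := by
  obtain ⟨ζ, hζ, hsum, hζΓ⟩ := exists_boundary_cutoffs hΓ.isClosed hΓ.disjoint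
  choose M hMc hM using fun i => exists_continuous_mul (Ω := Ω) hbdd (hζ i)
  have hmem : ∀ i, M i φ ∈ H10 Ω := fun i => by
    refine mul_mem_H10 hbdd (hζ i) (hMc i) (fun v => (hM i v).1) (S := Γ i) (fun y hy => ?_) (hφ i)
    rw [← hΓ.iUnion_eq] at hy
    obtain ⟨j, hj⟩ := Set.mem_iUnion.1 hy
    by_cases hji : j = i
    · exact .inl (hji ▸ hj)
    · exact .inr (by simpa [hji] using hζΓ i j y hj)
  -- Each `M i φ = ζ i φ` only uses the boundary value on `Γ i`, and the `ζ i` sum to `1`.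
  have heq : φ = ∑ i, M i φ := by
    refine H1_ext (Lp.ext ?_)
    have h1 : toL2 (∑ i, M i φ) = ∑ i, toL2 (M i φ) := map_sum (toL2Linear Ω) _ _
    rw [h1]
    filter_upwards [Lp.coeFn_finsetSum Finset.univ fun i => toL2 (M i φ),
      ae_all_iff.2 fun i => (hM i φ).1] with x h2 h3
    rw [h2, Finset.sum_apply, Finset.sum_congr rfl fun i _ => h3 i, ← Finset.sum_mul, hsum,
      one_mul]
  rw [heq]
  exact Submodule.sum_mem _ fun i _ => hmem i

/-! ### Orthogonality relations -/

theorem testH1_le_H10 : testH1 Ω ≤ H10 Ω := Submodule.le_topologicalClosure _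

/-- Density: `v ↦ (K, ∇v)` is continuous on `H¹`. -/
theorem integral_inner_grad_eq_zero_of_mem_H10 {K : E3 → E3}
    (hK : MemLp K 2 (volume.restrict (Ω : Set E3)))
    (h : ∀ v ∈ testH1 Ω, ∫ x in (Ω : Set E3), inner ℝ (K x) (grad v x) = 0) {v : H1 Ω}
    (hv : v ∈ H10 Ω) : ∫ x in (Ω : Set E3), inner ℝ (K x) (grad v x) = 0 := by
  have hinner : ∀ v : H1 Ω, ∫ x in (Ω : Set E3), inner ℝ (K x) (grad v x)
      = inner ℝ (hK.toLp K) (grad v) := fun v => by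
    rw [L2.inner_def]
    exact integral_congr_ae (hK.coeFn_toLp.mono fun x hx => by simp only [hx])
  simp only [hinner] at h ⊢
  have hc : Continuous fun v : H1 Ω => inner ℝ (hK.toLp K) (grad v) :=
    continuous_const.inner continuous_grad
  exact closure_minimal (s := (testH1 Ω : Set (H1 Ω))) (fun v hv => h v hv)
    (isClosed_eq hc continuous_const) hv

theorem exists_gradient_of_mem_testH1 (hbdd : Bornology.IsBounded (Ω : Set E3)) {v : H1 Ω}
    (hv : v ∈ testH1 Ω) : ∃ η : 𝓓(Ω, ℝ), toL2 v =ᵐ[volume.restrict (Ω : Set E3)] η ∧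
      grad v =ᵐ[volume.restrict (Ω : Set E3)] gradient η := by
  obtain ⟨η, hη⟩ := hv
  exact ⟨η, hη, grad_ae_eq_gradient hbdd η.contDiff.contDiffOn hη⟩

theorem H1_integral_apply (v : H1 Ω) (η : 𝓓(Ω, ℝ)) (k : Fin 3) :
    ∫ x in (Ω : Set E3), toL2 v x * gradient η x k = - ∫ x in (Ω : Set E3), η x * grad v x k := by
  have h := congrArg (EuclideanSpace.proj (𝕜 := ℝ) k) (H1_integral v η)
  rw [map_neg, ← ContinuousLinearMap.integral_comp_comm _
      (integrable_smul_of_memLp (Lp.memLp _) (memLp_gradient_test η)),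
    ← ContinuousLinearMap.integral_comp_comm _
      (integrable_smul_of_memLp (memLp_test η) (Lp.memLp _))] at h
  simpa using h

theorem memLp_curlOfGradients {μ : Measure E3} {J : Fin 3 → E3 → E3}
    (hJ : ∀ i, MemLp (J i) 2 μ) : MemLp (fun x => curlOfGradients fun i => J i x) 2 μ := by
  refine MemLp.of_eval_piLp fun i => ?_
  have h : ∀ i k, MemLp (fun x => J i x k) 2 μ := fun i k => (hJ i).eval_piLp k
  fin_cases i
  · exact (h 2 1).sub (h 1 2)
  · exact (h 0 2).sub (h 2 0)
  · exact (h 1 0).sub (h 0 1)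

/-- The six terms are those of a dot product with a curl in coordinates. -/
theorem integral_alternating {μ : Measure E3} {a b c d e f : E3 → ℝ} (ha : Integrable a μ)
    (hb : Integrable b μ) (hc : Integrable c μ) (hd : Integrable d μ) (he : Integrable e μ)
    (hf : Integrable f μ) :
    ∫ x, (((a x - b x) + (c x - d x)) + (e x - f x)) ∂μ
      = (((∫ x, a x ∂μ) - ∫ x, b x ∂μ) + ((∫ x, c x ∂μ) - ∫ x, d x ∂μ))
        + ((∫ x, e x ∂μ) - ∫ x, f x ∂μ) := by
  exact (integral_add ((ha.sub hb).add (hc.sub hd)) (he.sub hf)).trans (congrArg₂ _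
    ((integral_add (ha.sub hb) (hc.sub hd)).trans
      (congrArg₂ _ (integral_sub ha hb) (integral_sub hc hd))) (integral_sub he hf))

/-- Green's formula for the curl of a test field and an `[H¹(Ω)]³` field. -/
theorem integral_inner_curlOfGradients (θ : Fin 3 → 𝓓(Ω, ℝ)) (v : Fin 3 → H1 Ω) :
    ∫ x in (Ω : Set E3), inner ℝ (WithLp.toLp 2 fun i => θ i x : E3)
        (curlOfGradients fun i => grad (v i) x)
      = ∫ x in (Ω : Set E3), inner ℝ (curlOfGradients fun i => gradient (θ i) x)
        (WithLp.toLp 2 fun i => toL2 (v i) x) := by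
  have hT : ∀ j i k, Integrable (fun x => θ j x * grad (v i) x k)
      (volume.restrict (Ω : Set E3)) := fun j i k => by
    have := (integrable_smul_of_memLp (memLp_test (θ j)) (Lp.memLp (grad (v i)))).eval_piLp k
    simpa only [PiLp.smul_apply, smul_eq_mul] using this
  have hU : ∀ i j k, Integrable (fun x => toL2 (v i) x * gradient (θ j) x k)
      (volume.restrict (Ω : Set E3)) :=
    fun i j k => by
      have := (integrable_smul_of_memLp (Lp.memLp (toL2 (v i)))
        (memLp_gradient_test (θ j))).eval_piLp k
      simpa only [PiLp.smul_apply, smul_eq_mul] using this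
  have e1 : ∫ x in (Ω : Set E3), inner ℝ (WithLp.toLp 2 fun i => θ i x : E3)
        (curlOfGradients fun i => grad (v i) x)
      = ∫ x in (Ω : Set E3), (((θ 0 x * grad (v 2) x 1 - θ 0 x * grad (v 1) x 2)
        + (θ 1 x * grad (v 0) x 2 - θ 1 x * grad (v 2) x 0))
        + (θ 2 x * grad (v 1) x 0 - θ 2 x * grad (v 0) x 1)) := by
    congr 1; ext x
    simp [PiLp.inner_apply, Fin.sum_univ_three, curlOfGradients]
    ring
  have e2 : ∫ x in (Ω : Set E3), inner ℝ (curlOfGradients fun i => gradient (θ i) x)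
        (WithLp.toLp 2 fun i => toL2 (v i) x)
      = ∫ x in (Ω : Set E3), (((toL2 (v 0) x * gradient (θ 2) x 1
          - toL2 (v 0) x * gradient (θ 1) x 2)
        + (toL2 (v 1) x * gradient (θ 0) x 2 - toL2 (v 1) x * gradient (θ 2) x 0))
        + (toL2 (v 2) x * gradient (θ 1) x 0 - toL2 (v 2) x * gradient (θ 0) x 1)) := by
    congr 1; ext x
    simp [PiLp.inner_apply, Fin.sum_univ_three, curlOfGradients]
    ring
  rw [e1, e2,
    integral_alternating (hT 0 2 1) (hT 0 1 2) (hT 1 0 2) (hT 1 2 0) (hT 2 1 0) (hT 2 0 1),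
    integral_alternating (hU 0 2 1) (hU 0 1 2) (hU 1 0 2) (hU 1 2 0) (hU 2 1 0) (hU 2 0 1)]
  -- Each of the six products is integrated by parts; the antisymmetry of the curl absorbs the minus
  -- signs.
  simp only [H1_integral_apply]
  ring

theorem gradient_gradient_symm {ζ : E3 → ℝ} (hζ : ContDiff ℝ ∞ ζ) (x : E3) (j k : Fin 3) :
    gradient (fun y => gradient ζ y j) x k = gradient (fun y => gradient ζ y k) x j := by
  have hd : DifferentiableAt ℝ (fderiv ℝ ζ) x :=
    (hζ.fderiv_right (m := ∞) le_rfl).differentiable (by simp) x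
  have h : ∀ j k : Fin 3, gradient (fun y => gradient ζ y j) x k
      = fderiv ℝ (fderiv ℝ ζ) x (EuclideanSpace.single k 1) (EuclideanSpace.single j 1) := by
    intro j k
    simp only [gradient_apply]
    rw [fderiv_clm_apply hd (differentiableAt_const _)]
    simp
  rw [h, h]
  exact (hζ.contDiffAt.isSymmSndFDerivAt (by
    simpa using (WithTop.coe_le_coe.2 le_top : ((2 : ℕ∞) : WithTop ℕ∞) ≤ ((⊤ : ℕ∞) : WithTop ℕ∞)))) _ _

/-- The gradient of a smooth function that is locally constant near `∂Ω` is orthogonal to curls. -/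
theorem integral_inner_gradient_curlOfGradients (hbdd : Bornology.IsBounded (Ω : Set E3))
    {ζ : E3 → ℝ} (hζ : ContDiff ℝ ∞ ζ)
    (h0 : ∀ y ∈ frontier (Ω : Set E3), ∀ᶠ x in 𝓝 y, gradient ζ x = 0) (v : Fin 3 → H1 Ω) :
    ∫ x in (Ω : Set E3), inner ℝ (gradient ζ x) (curlOfGradients fun i => grad (v i) x) = 0 := by
  have hcd : ∀ j, ContDiff ℝ ∞ fun x => gradient ζ x j := fun j => by
    simp only [gradient_apply]
    exact (hζ.fderiv_right (by simp)).clm_apply contDiff_const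
  -- The components of `∇ζ` vanish near `∂Ω`, hence are test functions `θ j`. Green's formula moves
  -- the curl onto them, and the curl of `∇ζ` is zero.
  choose θ hθ using fun j => exists_testFunction_eqOn (Ω := Ω) hbdd (hcd j).contDiffOn
    fun y hy => ((h0 y hy).filter_mono nhdsWithin_le_nhds).mono fun x hx => by
      rw [hx, PiLp.zero_apply]
  have e : ∫ x in (Ω : Set E3), inner ℝ (gradient ζ x) (curlOfGradients fun i => grad (v i) x)
      = ∫ x in (Ω : Set E3), inner ℝ (WithLp.toLp 2 fun i => θ i x : E3)
        (curlOfGradients fun i => grad (v i) x) := by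
    refine setIntegral_congr_fun Ω.isOpen.measurableSet fun x hx => ?_
    have : gradient ζ x = (WithLp.toLp 2 fun i => θ i x : E3) := by
      ext i
      exact (hθ i hx).symm
    rw [this]
  rw [e, integral_inner_curlOfGradients]
  refine setIntegral_eq_zero_of_forall_eq_zero fun x hx => ?_
  have hg : ∀ j, gradient (θ j) x = gradient (fun y => gradient ζ y j) x :=
    fun j => gradient_eqOn (hθ j) hx
  have : (curlOfGradients fun i => gradient (θ i) x) = 0 := by
    simp only [hg]
    ext i
    fin_cases i
    · simp [curlOfGradients, gradient_gradient_symm hζ x 2 1]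
    · simp [curlOfGradients, gradient_gradient_symm hζ x 0 2]
    · simp [curlOfGradients, gradient_gradient_symm hζ x 1 0]
  rw [this, inner_zero_left]

/-! ### Functions with vanishing weak gradient -/

theorem eq_zero_of_apply_single_eq_zero {D : E3 →L[ℝ] ℝ}
    (h : ∀ k, D (EuclideanSpace.single k 1) = 0) : D = 0 := by
  ext x
  rw [← (EuclideanSpace.basisFun (Fin 3) ℝ).sum_repr x, map_sum]
  simp [h]

open scoped Convolution in
/-- A function whose weak gradient vanishes in a ball is a.e. constant in a smaller ball. -/
theorem exists_ae_eq_const_of_weakGradient_eq_zero {F : E3 → ℝ} (hF : LocallyIntegrable F)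
    {y : E3} {r : ℝ} (hr : 0 < r)
    (h : ∀ η : E3 → ℝ, ContDiff ℝ ∞ η → HasCompactSupport η → tsupport η ⊆ Metric.ball y r →
      ∀ k, ∫ x, F x * gradient η x k = 0) :
    ∃ c : ℝ, ∀ᵐ x, x ∈ Metric.ball y (r / 2) → F x = c := by
  have hδ : ∀ n : ℕ, 0 < r / 2 / (n + 1) / 2 := fun n => by positivity
  -- The outer radius is at most `r / 2`, so a kernel centred in the half ball is supported in `ball
  -- y r`. It is twice the inner radius, which gives the ratio bound `K = 2` needed for a.e.
  -- convergence of the mollifications.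
  let φ : ℕ → ContDiffBump (0 : E3) := fun n =>
    ⟨r / 2 / (n + 1) / 2, r / 2 / (n + 1), hδ n, half_lt_self (by positivity)⟩
  have hφlim : Tendsto (fun n => (φ n).rOut) atTop (𝓝 0) :=
    tendsto_const_nhds.div_atTop
      (tendsto_atTop_add_const_right _ _ tendsto_natCast_atTop_atTop)
  have hconv := ContDiffBump.ae_convolution_tendsto_right_of_locallyIntegrable
    (μ := (volume : Measure E3)) (φ := φ) (K := 2) hφlim
    (.of_forall fun n => by change r / 2 / (n + 1) ≤ 2 * (r / 2 / (n + 1) / 2); linarith) hF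
  set f : ℕ → E3 → ℝ := fun n =>
    (φ n).normed volume ⋆[ContinuousLinearMap.lsmul ℝ ℝ (E := ℝ), volume] F with hf
  have hderiv : ∀ n, ∀ x ∈ Metric.ball y (r / 2), HasFDerivAt (f n) (0 : E3 →L[ℝ] ℝ) x := by
    intro n x hx
    set g := (φ n).normed volume with hg
    have hgs : ContDiff ℝ ∞ g := (φ n).contDiff_normed
    have hgc : HasCompactSupport g := (φ n).hasCompactSupport_normed
    have hd := hgc.hasFDerivAt_convolution_right
      (ContinuousLinearMap.lsmul ℝ ℝ (E := ℝ)).flip hF (hgs.of_le (by simp)) x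
    rw [convolution_flip] at hd
    refine hd.congr_fderiv (eq_zero_of_apply_single_eq_zero fun k => ?_)
    rw [convolution_precompR_apply _ hF (hgc.fderiv ℝ) (hgs.continuous_fderiv (by simp))]
    -- The derivative of the mollification at `x` is, up to sign, `F` integrated against the
    -- gradient of the reflected kernel `η`, which is admissible in `h`.
    set η : E3 → ℝ := fun z => g (x - z) with hη
    have hηd : ∀ z, gradient η z k = - fderiv ℝ g (x - z) (EuclideanSpace.single k 1) := by
      intro z
      have h1 : HasFDerivAt η ((fderiv ℝ g (x - z)).comp (-ContinuousLinearMap.id ℝ E3)) z :=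
        HasFDerivAt.comp z (hgs.differentiable (by simp) (x - z)).hasFDerivAt
          ((hasFDerivAt_id z).const_sub x)
      rw [gradient_apply, h1.fderiv]
      simp
    have hηsub : Function.support η ⊆ Metric.closedBall x (φ n).rOut := by
      intro z hz
      have : x - z ∈ tsupport g := subset_tsupport _ hz
      rw [hg, (φ n).tsupport_normed_eq, mem_closedBall_zero_iff, ← dist_eq_norm, dist_comm] at this
      exact this
    have hball : Metric.closedBall x (φ n).rOut ⊆ Metric.ball y r := by
      refine Metric.closedBall_subset_ball' ?_
      have h1 : (φ n).rOut ≤ r / 2 := div_le_self (by positivity) (by simp)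
      have h2 := Metric.mem_ball.1 hx
      linarith
    have hηts : tsupport η ⊆ Metric.closedBall x (φ n).rOut :=
      closure_minimal hηsub Metric.isClosed_closedBall
    have hηc : HasCompactSupport η :=
      (isCompact_closedBall x (φ n).rOut).of_isClosed_subset (isClosed_tsupport η) hηts
    have := h η (hgs.comp (contDiff_const.sub contDiff_id)) hηc (hηts.trans hball) k
    simp only [hηd, mul_neg, integral_neg, neg_eq_zero] at this
    rw [convolution_def]
    simpa [mul_comm] using this
  have hconst : ∀ n, ∀ x ∈ Metric.ball y (r / 2), f n x = f n y := fun n x hx =>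
    Metric.isOpen_ball.is_const_of_fderiv_eq_zero (𝕜 := ℝ)
      (convex_ball y (r / 2)).isPreconnected
      (fun z hz => (hderiv n z hz).differentiableAt.differentiableWithinAt)
      (fun z hz => (hderiv n z hz).fderiv) hx (Metric.mem_ball_self (by positivity))
  -- On the half ball `f n` is the constant `f n y`, so these constants converge to `F x` for a.e.
  -- such `x`; the limit does not depend on `x`.
  refine ⟨limUnder atTop fun n => f n y, ?_⟩
  filter_upwards [hconv] with x hx hxb
  refine (Tendsto.limUnder_eq (hx.congr fun n => hconst n x hxb)).symm

theorem eq_of_ae_eq_const {F : E3 → ℝ} {V : Set E3} (hV : IsOpen V) (hne : V.Nonempty) {c c' : ℝ}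
    (h : ∀ᵐ x, x ∈ V → F x = c) (h' : ∀ᵐ x, x ∈ V → F x = c') : c = c' := by
  by_contra hcc
  refine (hV.measure_pos volume hne).ne' ?_
  refine measure_mono_null (fun x hx => ?_) (ae_iff.1 (h.and h'))
  exact fun hx' => hcc ((hx'.1 hx).symm.trans (hx'.2 hx))

/-- A locally a.e. constant function on a connected open set that vanishes a.e. on a nonempty
open subset vanishes a.e. -/
theorem ae_eq_zero_of_locally_const {F : E3 → ℝ} {U : Set E3} (hU : IsPreconnected U)
    (hc : ∀ y ∈ U, ∃ r > 0, ∃ c : ℝ, ∀ᵐ x, x ∈ Metric.ball y r → F x = c) {V : Set E3}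
    (hV : IsOpen V) (hVU : (U ∩ V).Nonempty) (hF : ∀ᵐ x, x ∈ V → F x = 0) :
    ∀ᵐ x, x ∈ U → F x = 0 := by
  -- `P s` collects the points near which `F` is a.e. equal to a constant in `s`. `P {0}` and `P
  -- {0}ᶜ` are open, disjoint and cover `U`, and the first meets `U`.
  set P : Set ℝ → Set E3 := fun s =>
    {y | ∃ c ∈ s, ∃ r > 0, ∀ᵐ x, x ∈ Metric.ball y r → F x = c} with hP
  have hopen : ∀ s, IsOpen (P s) := by
    refine fun s => Metric.isOpen_iff.2 ?_
    rintro y ⟨c, hcs, r, hr, hy⟩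
    refine ⟨r / 2, by positivity, fun z hz => ⟨c, hcs, r / 2, by positivity, ?_⟩⟩
    filter_upwards [hy] with x hx hxz
    refine hx ?_
    have h1 := dist_triangle x z y
    rw [Metric.mem_ball] at *
    linarith
  have hdisj : Disjoint (P {0}) (P {0}ᶜ) := by
    rw [Set.disjoint_left]
    rintro y ⟨c, rfl, r, hr, hy⟩ ⟨c', hc', r', hr', hy'⟩
    refine hc' (eq_of_ae_eq_const (F := F) (V := Metric.ball y (min r r')) Metric.isOpen_ball
      ⟨y, Metric.mem_ball_self (lt_min hr hr')⟩ ?_ ?_).symm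
    · filter_upwards [hy] with x hx hxb
      exact hx (Metric.ball_subset_ball (min_le_left _ _) hxb)
    · filter_upwards [hy'] with x hx hxb
      exact hx (Metric.ball_subset_ball (min_le_right _ _) hxb)
  have hsub : U ⊆ P {0} := by
    refine hU.subset_left_of_subset_union (hopen _) (hopen _) hdisj (fun y hy => ?_) ?_
    · obtain ⟨r, hr, c, h⟩ := hc y hy
      by_cases h0 : c = 0
      · exact .inl ⟨c, h0, r, hr, h⟩
      · exact .inr ⟨c, h0, r, hr, h⟩
    · obtain ⟨y, hyU, hyV⟩ := hVU
      obtain ⟨r, hr, hrV⟩ := Metric.isOpen_iff.1 hV y hyV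
      exact ⟨y, hyU, 0, rfl, r, hr, hF.mono fun x hx hxb => hx (hrV hxb)⟩
  rw [ae_iff]
  refine measure_null_of_locally_null _ fun y hy => ?_
  simp only [Set.mem_ofPred_eq, Classical.not_imp] at hy
  obtain ⟨c, rfl, r, hr, h⟩ := hsub hy.1
  refine ⟨_, inter_mem_nhdsWithin _ (Metric.ball_mem_nhds y hr), ?_⟩
  refine measure_mono_null ?_ (ae_iff.1 h)
  rintro x ⟨hx, hxb⟩
  simp only [Set.mem_ofPred_eq, Classical.not_imp] at hx ⊢
  exact ⟨hxb, hx.2⟩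

/-- The extension by zero of a function in `H¹₀(Ω)` is weakly differentiable. -/
theorem integral_mul_gradient_of_mem_H10 (hbdd : Bornology.IsBounded (Ω : Set E3)) {v : H1 Ω}
    (hv : v ∈ H10 Ω) {η : E3 → ℝ} (hη : ContDiff ℝ ∞ η) (k : Fin 3) :
    ∫ x in (Ω : Set E3), toL2 v x * gradient η x k = - ∫ x in (Ω : Set E3), η x * grad v x k := by
  have hm1 : MemLp (fun x => gradient η x k) 2 (volume.restrict (Ω : Set E3)) :=
    (memLp_of_continuous hbdd (continuous_gradient hη)).eval_piLp k
  have hm2 : MemLp (fun x => η x • (EuclideanSpace.single k 1 : E3)) 2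
      (volume.restrict (Ω : Set E3)) :=
    memLp_of_continuous hbdd (hη.continuous.smul continuous_const)
  have e1 : ∀ v : H1 Ω, ∫ x in (Ω : Set E3), toL2 v x * gradient η x k
      = inner ℝ (hm1.toLp _) (toL2 v) := fun v => by
    rw [L2.inner_def]
    refine integral_congr_ae (hm1.coeFn_toLp.mono fun x hx => ?_)
    simp only [hx]
    simp
  have e2 : ∀ v : H1 Ω, ∫ x in (Ω : Set E3), η x * grad v x k
      = inner ℝ (hm2.toLp _) (grad v) := fun v => by
    rw [L2.inner_def]
    refine integral_congr_ae (hm2.coeFn_toLp.mono fun x hx => ?_)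
    simp only [hx]
    simp [inner_smul_left, EuclideanSpace.inner_single_left]
  have hcl : IsClosed {v : H1 Ω | inner ℝ (hm1.toLp _) (toL2 v)
      = - inner ℝ (hm2.toLp _) (grad v)} :=
    isClosed_eq (continuous_const.inner continuous_toL2)
      (continuous_const.inner continuous_grad).neg
  rw [e1, e2]
  refine closure_minimal (s := (testH1 Ω : Set (H1 Ω))) (fun v hv => ?_) hcl hv
  rw [Set.mem_ofPred_eq, ← e1, ← e2]
  obtain ⟨θ, hθ, hθg⟩ := exists_gradient_of_mem_testH1 hbdd hv
  obtain ⟨z, hz, hzg⟩ := exists_H1_of_contDiff (Ω := Ω) hbdd hη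
  -- For `v = θ` a test function the roles are exchanged: the smooth `η`, as an element `z` of `H¹`,
  -- is tested against `θ`. Hence `η` needs no compact support in `Ω`.
  have key := H1_integral_apply z θ k
  have k1 : ∫ x in (Ω : Set E3), toL2 z x * gradient θ x k
      = ∫ x in (Ω : Set E3), η x * grad v x k := by
    refine integral_congr_ae ?_
    filter_upwards [hz, hθg] with x h1 h2
    rw [h1, h2]
  have k2 : ∫ x in (Ω : Set E3), θ x * grad z x k
      = ∫ x in (Ω : Set E3), toL2 v x * gradient η x k := by
    refine integral_congr_ae ?_
    filter_upwards [hzg, hθ] with x h1 h2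
    rw [h1, h2]
  rw [k1, k2] at key
  rw [key, neg_neg]

/-- A function with vanishing gradient and boundary value `0` on `Γ 0` vanishes. -/
theorem eq_zero_of_grad_eq_zero (hbdd : Bornology.IsBounded (Ω : Set E3))
    (hconn : IsConnected (Ω : Set E3)) (hreg : interior (closure (Ω : Set E3)) = Ω) {L : ℕ}
    {Γ : Fin (L + 1) → Set E3} (hΓ : IsBoundaryDecomposition (Ω : Set E3) L Γ) {s : H1 Ω}
    (hs : HasBoundaryValue s (Γ 0) 0)
    (hgrad : grad s =ᵐ[volume.restrict (Ω : Set E3)] 0) : s = 0 := by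
  classical
  have hfin : IsFiniteMeasure (volume.restrict (Ω : Set E3)) :=
    ⟨by rw [Measure.restrict_apply_univ]; exact hbdd.measure_lt_top⟩
  -- `F` is the extension of `s` by zero.
  set F : E3 → ℝ := (Ω : Set E3).indicator (toL2 s) with hFdef
  have hF : LocallyIntegrable F := by
    refine Integrable.locallyIntegrable ?_
    rw [hFdef, integrable_indicator_iff Ω.isOpen.measurableSet]
    exact (Lp.memLp (toL2 s)).integrable (by norm_num)
  have hFint : ∀ a : E3 → ℝ, ∫ x, F x * a x = ∫ x in (Ω : Set E3), toL2 s x * a x := fun a => by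
    rw [← integral_indicator Ω.isOpen.measurableSet]
    congr 1; ext x
    by_cases hx : x ∈ (Ω : Set E3)
    · simp only [hFdef, Set.indicator_of_mem hx]
    · simp only [hFdef, Set.indicator_of_notMem hx, zero_mul]
  have hloc : ∀ y ∈ (Ω : Set E3), ∃ r > 0, ∃ c : ℝ, ∀ᵐ x, x ∈ Metric.ball y r → F x = c := by
    intro y hy
    obtain ⟨r, hr, hrΩ⟩ := Metric.isOpen_iff.1 Ω.isOpen y hy
    refine ⟨r / 2, by positivity, exists_ae_eq_const_of_weakGradient_eq_zero hF hr
      fun η hη hηc hηs k => ?_⟩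
    rw [hFint]
    refine (H1_integral_apply s ⟨η, hη, hηc, hηs.trans hrΩ⟩ k).trans ?_
    rw [neg_eq_zero]
    refine integral_eq_zero_of_ae (hgrad.mono fun x hx => ?_)
    simp [hx]
  obtain ⟨y, hy⟩ := (hΓ.isConnected 0).nonempty
  have hyfr : y ∈ frontier (Ω : Set E3) := by
    rw [← hΓ.iUnion_eq]; exact Set.mem_iUnion.2 ⟨0, hy⟩
  obtain ⟨ζ, hζ, -, hζΓ⟩ := exists_boundary_cutoffs hΓ.isClosed hΓ.disjoint
  obtain ⟨M, hMc, hM⟩ := exists_continuous_mul (Ω := Ω) hbdd (hζ 0)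
  have hMs : M s ∈ H10 Ω := by
    refine mul_mem_H10 hbdd (hζ 0) hMc (fun v => (hM v).1) (S := Γ 0) (fun z hz => ?_) hs
    rw [← hΓ.iUnion_eq] at hz
    obtain ⟨j, hj⟩ := Set.mem_iUnion.1 hz
    by_cases hj0 : j = 0
    · exact .inl (hj0 ▸ hj)
    · exact .inr (by simpa [hj0] using hζΓ 0 j z hj)
  obtain ⟨r, hr, hζr⟩ := Metric.eventually_nhds_iff_ball.1 (hζΓ 0 0 y hy)
  simp only [if_true] at hζr
  have hζg : ∀ x ∈ Metric.ball y r, gradient (ζ 0) x = 0 := fun x hx => by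
    have : ζ 0 =ᶠ[𝓝 x] fun _ => (1 : ℝ) :=
      eventuallyEq_of_mem (Metric.isOpen_ball.mem_nhds hx) hζr
    rw [this.gradient_eq]
    simp [gradient]
  -- Near `y` the cutoff is `1`, so there `F` agrees with the zero extension of `M s ∈ H¹₀`. That
  -- extension is weakly differentiable across `∂Ω`, and its gradient vanishes in the ball.
  obtain ⟨c, hc⟩ := exists_ae_eq_const_of_weakGradient_eq_zero hF hr fun η hη hηc hηs k => by
    have hη0 : ∀ x ∉ Metric.ball y r, η x = 0 ∧ gradient η x = 0 := fun x hx =>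
      ⟨image_eq_zero_of_notMem_tsupport fun h => hx (hηs h),
        image_eq_zero_of_notMem_tsupport fun h => hx (hηs (tsupport_gradient_subset _ h))⟩
    rw [hFint]
    have h1 : ∫ x in (Ω : Set E3), toL2 s x * gradient η x k
        = ∫ x in (Ω : Set E3), toL2 (M s) x * gradient η x k := by
      refine integral_congr_ae ((hM s).1.mono fun x hx => ?_)
      by_cases hxb : x ∈ Metric.ball y r
      · simp only [hx, hζr x hxb, one_mul]
      · simp [(hη0 x hxb).2]
    rw [h1, integral_mul_gradient_of_mem_H10 hbdd hMs hη k, neg_eq_zero]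
    refine integral_eq_zero_of_ae ?_
    filter_upwards [(hM s).2, hgrad] with x h2 h3
    by_cases hxb : x ∈ Metric.ball y r
    · simp [h2, h3, hζg x hxb]
    · simp [(hη0 x hxb).1]
  -- As `Ω` is the interior of its closure, `y` is a limit of points outside `closure Ω`. There `F =
  -- 0`, which forces `c = 0`.
  have hyc : y ∈ closure (closure (Ω : Set E3))ᶜ := by
    rw [closure_compl, hreg]
    exact (Ω.isOpen.frontier_eq ▸ hyfr).2
  have hball : Metric.ball y (r / 2) ∈ 𝓝 y := Metric.ball_mem_nhds y (by positivity)
  have hc0 : c = 0 := by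
    refine eq_of_ae_eq_const (F := F) (V := Metric.ball y (r / 2) ∩ (closure (Ω : Set E3))ᶜ)
      (Metric.isOpen_ball.inter isClosed_closure.isOpen_compl)
      (mem_closure_iff_nhds.1 hyc _ hball) (hc.mono fun x hx hxV => hx hxV.1)
      (.of_forall fun x hx => Set.indicator_of_notMem (fun h => hx.2 (subset_closure h)) _)
  have hV : ((Ω : Set E3) ∩ Metric.ball y (r / 2)).Nonempty := by
    rw [Set.inter_comm]
    exact mem_closure_iff_nhds.1 (frontier_subset_closure hyfr) _ hball
  have hzero := ae_eq_zero_of_locally_const hconn.isPreconnected hloc Metric.isOpen_ball hV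
    (hc0 ▸ hc)
  refine H1_ext (Lp.ext ?_)
  refine EventuallyEq.trans ?_ (Lp.coeFn_zero ℝ 2 (volume.restrict (Ω : Set E3))).symm
  rw [EventuallyEq, ae_restrict_iff' Ω.isOpen.measurableSet]
  filter_upwards [hzero] with x hx hxΩ
  exact (Set.indicator_of_mem hxΩ _).symm.trans (hx hxΩ)

/-! ### Fields in `H₀(curl; Ω)` -/

theorem toL2_zero_ae :
    toL2 (0 : H1 Ω) =ᵐ[volume.restrict (Ω : Set E3)] 0 :=
  Lp.coeFn_zero ℝ 2 (volume.restrict (Ω : Set E3))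

theorem grad_zero_ae :
    grad (0 : H1 Ω) =ᵐ[volume.restrict (Ω : Set E3)] 0 :=
  Lp.coeFn_zero E3 2 (volume.restrict (Ω : Set E3))

theorem integral_inner_zero_left (K : E3 → E3) :
    ∫ x in (Ω : Set E3), inner ℝ ((0 : L2Vec Ω) x) (K x) = 0 := by
  refine integral_eq_zero_of_ae ?_
  filter_upwards [Lp.coeFn_zero E3 2 (volume.restrict (Ω : Set E3))] with x hx
  rw [hx, Pi.zero_apply, inner_zero_left, Pi.zero_apply]

theorem integral_inner_zero_right (K : E3 → E3) :
    ∫ x in (Ω : Set E3), inner ℝ (K x) ((0 : L2Vec Ω) x) = 0 := by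
  refine integral_eq_zero_of_ae ?_
  filter_upwards [Lp.coeFn_zero E3 2 (volume.restrict (Ω : Set E3))] with x hx
  rw [hx, Pi.zero_apply, inner_zero_right, Pi.zero_apply]

theorem exists_testFunction_components (hbdd : Bornology.IsBounded (Ω : Set E3)) (w : 𝓓(Ω, E3)) :
    ∃ θ : Fin 3 → 𝓓(Ω, ℝ), (∀ i, Set.EqOn (θ i) (fun x => w x i) Ω) ∧
      ∀ x ∈ Ω, (curlOfGradients fun i => gradient (θ i) x) = curl w x := by
  choose θ hθ using fun i : Fin 3 => exists_testFunction_eqOn (Ω := Ω) hbdd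
    (h := fun x => w x i) (contDiff_euclidean.1 w.contDiff i).contDiffOn fun y hy =>
      ((testFunction_eventually_eq_zero w hy).filter_mono nhdsWithin_le_nhds).mono fun x hx => by
        rw [hx, PiLp.zero_apply]
  refine ⟨θ, hθ, fun x hx => ?_⟩
  rw [curl]
  congr 1
  ext1 i
  exact gradient_eqOn (hθ i) hx

/-- Test fields have components in `H¹(Ω)`, so Green's formula already contains the distributional
curl. -/
theorem memH0Curl_of_green (hbdd : Bornology.IsBounded (Ω : Set E3)) {v c : L2Vec Ω}
    (h : ∀ w : Fin 3 → H1 Ω,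
      ∫ x in (Ω : Set E3), inner ℝ (v x) (curlOfGradients fun i => grad (w i) x)
        = ∫ x in (Ω : Set E3), inner ℝ (c x) (WithLp.toLp 2 fun i => toL2 (w i) x)) :
    MemH0Curl v c := by
  refine ⟨fun w => ?_, h⟩
  obtain ⟨θ, hθ, hcurl⟩ := exists_testFunction_components hbdd w
  choose W hW hWg using fun i => exists_H1_of_contDiff (Ω := Ω) hbdd (θ i).contDiff
  have h1 : ∫ x in (Ω : Set E3), inner ℝ (v x) (curlOfGradients fun i => grad (W i) x)
      = ∫ x in (Ω : Set E3), inner ℝ (v x) (curl w x) := by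
    refine integral_congr_ae ?_
    filter_upwards [ae_all_iff.2 hWg, ae_restrict_mem Ω.isOpen.measurableSet] with x h2 hx
    simp only [h2, hcurl x hx]
  have h2 : ∫ x in (Ω : Set E3), inner ℝ (c x) (WithLp.toLp 2 fun i => toL2 (W i) x)
      = ∫ x in (Ω : Set E3), inner ℝ (c x) (w x) := by
    refine integral_congr_ae ?_
    filter_upwards [ae_all_iff.2 hW, ae_restrict_mem Ω.isOpen.measurableSet] with x h3 hx
    have : (WithLp.toLp 2 fun i => toL2 (W i) x : E3) = w x := by
      ext i
      exact (h3 i).trans (hθ i hx)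
    simp only [this]
  rw [← h1, ← h2, h W]

/-- Test fields belong to `H₀(curl; Ω)`. -/
theorem exists_memH0Curl_testFunction (hbdd : Bornology.IsBounded (Ω : Set E3)) (w : 𝓓(Ω, E3)) :
    ∃ ψ c : L2Vec Ω, MemH0Curl ψ c ∧ ψ =ᵐ[volume.restrict (Ω : Set E3)] w ∧
      c =ᵐ[volume.restrict (Ω : Set E3)] curl w := by
  obtain ⟨θ, hθ, hcurl⟩ := exists_testFunction_components hbdd w
  have hψ : MemLp w 2 (volume.restrict (Ω : Set E3)) := memLp_of_continuous hbdd w.continuous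
  have hc0 : MemLp (fun x => curlOfGradients fun i => gradient (θ i) x) 2
      (volume.restrict (Ω : Set E3)) := memLp_curlOfGradients fun i => memLp_gradient_test (θ i)
  refine ⟨hψ.toLp _, hc0.toLp _, memH0Curl_of_green hbdd fun v => ?_, hψ.coeFn_toLp, ?_⟩
  · have key := integral_inner_curlOfGradients θ v
    have h1 : ∫ x in (Ω : Set E3), inner ℝ (hψ.toLp _ x) (curlOfGradients fun i => grad (v i) x)
        = ∫ x in (Ω : Set E3), inner ℝ (WithLp.toLp 2 fun i => θ i x : E3)
          (curlOfGradients fun i => grad (v i) x) := by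
      refine integral_congr_ae ?_
      filter_upwards [hψ.coeFn_toLp, ae_restrict_mem Ω.isOpen.measurableSet] with x h2 hx
      have : (WithLp.toLp 2 fun i => θ i x : E3) = w x := by
        ext i
        exact hθ i hx
      simp only [h2, this]
    rw [h1, key]
    exact integral_congr_ae (hc0.coeFn_toLp.mono fun x hx => by simp only [hx])
  · filter_upwards [hc0.coeFn_toLp, ae_restrict_mem Ω.isOpen.measurableSet] with x h1 hx
    rw [h1, hcurl x hx]

/-- If `K` is orthogonal to the gradients of test functions and of functions `χ i` whose boundary
values are the indicator functions of the `Γ i`, it is orthogonal to `∇H¹_{0c}(Ω)`. -/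
theorem integral_inner_grad_eq_zero_of_memH10c (hbdd : Bornology.IsBounded (Ω : Set E3)) {L : ℕ}
    {Γ : Fin (L + 1) → Set E3} (hΓ : IsBoundaryDecomposition (Ω : Set E3) L Γ) {K : E3 → E3}
    (hK : MemLp K 2 (volume.restrict (Ω : Set E3)))
    (hKtest : ∀ v ∈ testH1 Ω, ∫ x in (Ω : Set E3), inner ℝ (K x) (grad v x) = 0)
    {χ : Fin L → H1 Ω}
    (hχ : ∀ i j, HasBoundaryValue (χ i) (Γ j) (if j = i.succ then 1 else 0))
    (hKχ : ∀ i, ∫ x in (Ω : Set E3), inner ℝ (K x) (grad (χ i) x) = 0) {s : H1 Ω}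
    (hs : MemH10c Γ s) : ∫ x in (Ω : Set E3), inner ℝ (K x) (grad s x) = 0 := by
  obtain ⟨hs0, hsα⟩ := hs
  choose α hα using hsα
  -- Subtracting `∑ α i χ i` removes the constants on the inner components and leaves the zero value
  -- on `Γ 0`, so `v` lies in `H¹₀`.
  set v : H1 Ω := s + ∑ i, (-α i) • χ i with hv
  have hv10 : v ∈ H10 Ω := by
    refine mem_H10_of_hasBoundaryValue_zero hbdd hΓ fun j => ?_
    have hsum : HasBoundaryValue (∑ i, (-α i) • χ i) (Γ j)
        (∑ i, (-α i) * if j = i.succ then 1 else 0) :=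
      HasBoundaryValue.sum _ fun i _ => (hχ i j).smul _
    induction j using Fin.cases with
    | zero => simpa [hv, (Fin.succ_ne_zero _).symm] using hs0.add hsum
    | succ k => simpa [hv] using (hα k).add hsum
  have hinner : ∀ v : H1 Ω, ∫ x in (Ω : Set E3), inner ℝ (K x) (grad v x)
      = ((innerSL ℝ (hK.toLp K)).toLinearMap.comp (gradLinear Ω)) v := fun v => by
    change _ = inner ℝ (hK.toLp K) (grad v)
    rw [L2.inner_def]
    exact integral_congr_ae (hK.coeFn_toLp.mono fun x hx => by simp only [hx])
  have hv0 := integral_inner_grad_eq_zero_of_mem_H10 hK hKtest hv10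
  rw [hinner, hv, map_add, map_sum] at hv0
  have hχ0 : ∀ i, ((innerSL ℝ (hK.toLp K)).toLinearMap.comp (gradLinear Ω)) ((-α i) • χ i) = 0 :=
    fun i => by rw [map_smul, ← hinner, hKχ, smul_zero]
  rw [Finset.sum_congr rfl fun i _ => hχ0 i, Finset.sum_const_zero, add_zero, ← hinner] at hv0
  exact hv0

/-- The gradients of functions in `H¹_{0c}(Ω)` are curl-free fields in `H₀(curl; Ω)`. -/
theorem memH0Curl_grad (hbdd : Bornology.IsBounded (Ω : Set E3)) {L : ℕ}
    {Γ : Fin (L + 1) → Set E3} (hΓ : IsBoundaryDecomposition (Ω : Set E3) L Γ) {s : H1 Ω}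
    (hs : MemH10c Γ s) : MemH0Curl (grad s) 0 := by
  refine memH0Curl_of_green hbdd fun w => ?_
  rw [integral_inner_zero_left]
  have hK : MemLp (fun x => curlOfGradients fun i => grad (w i) x) 2
      (volume.restrict (Ω : Set E3)) := memLp_curlOfGradients fun i => Lp.memLp (grad (w i))
  have hsmooth : ∀ (v : H1 Ω) (ζ : E3 → ℝ), ContDiff ℝ ∞ ζ →
      grad v =ᵐ[volume.restrict (Ω : Set E3)] gradient ζ →
      (∀ y ∈ frontier (Ω : Set E3), ∀ᶠ x in 𝓝 y, gradient ζ x = 0) →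
      ∫ x in (Ω : Set E3), inner ℝ (curlOfGradients fun i => grad (w i) x) (grad v x) = 0 := by
    intro v ζ hζ hv hζ0
    rw [← integral_inner_gradient_curlOfGradients hbdd hζ hζ0 w]
    exact integral_congr_ae (hv.mono fun x hx => by simp only [hx]; rw [real_inner_comm])
  obtain ⟨ζ, hζ, -, hζΓ⟩ := exists_boundary_cutoffs hΓ.isClosed hΓ.disjoint
  choose Z hZ hZg using fun i : Fin L => exists_H1_of_contDiff (Ω := Ω) hbdd (hζ i.succ)
  -- The `χ i` are taken to be the cutoffs themselves. Like test functions, they are locally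
  -- constant near `∂Ω`, so their gradients are orthogonal to curls.
  have key := integral_inner_grad_eq_zero_of_memH10c hbdd hΓ hK (fun v hv => ?_) (χ := Z)
    (fun i j => ?_) (fun i => hsmooth (Z i) (ζ i.succ) (hζ i.succ) (hZg i) fun y hy => ?_) hs
  · rw [← key]
    exact integral_congr_ae (.of_forall fun x => real_inner_comm _ _)
  · obtain ⟨η, -, hη⟩ := exists_gradient_of_mem_testH1 hbdd hv
    exact hsmooth v η η.contDiff hη fun y hy => eventually_eq_zero_of_tsupport_subset
      ((tsupport_gradient_subset _).trans η.tsupport_subset) hy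
  · refine subset_closure ⟨ζ i.succ, (hζ i.succ).contDiffOn, hZ i, fun y hy => ?_⟩
    exact tendsto_const_nhds.congr' (((hζΓ i.succ j y hy).filter_mono nhdsWithin_le_nhds).mono
      fun x hx => hx.symm)
  · rw [← hΓ.iUnion_eq] at hy
    obtain ⟨j, hj⟩ := Set.mem_iUnion.1 hy
    filter_upwards [(hζΓ i.succ j y hj).eventually_nhds] with x hx
    rw [EventuallyEq.gradient_eq hx]
    simp [gradient]

/-! ### Coefficient matrices -/

theorem IsCoefficient.memLp {ε : E3 → Matrix (Fin 3) (Fin 3) ℝ} (hε : IsCoefficient Ω ε)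
    {v : E3 → E3} (hv : MemLp v 2 (volume.restrict (Ω : Set E3))) :
    MemLp (fun x => Matrix.toEuclideanLin (ε x) (v x)) 2 (volume.restrict (Ω : Set E3)) := by
  refine MemLp.of_eval_piLp fun i => ?_
  have h : ∀ j, MemLp (fun x => ε x i j * v x j) 2 (volume.restrict (Ω : Set E3)) := fun j =>
    (hv.eval_piLp j).mul (hε.memLp_top i j)
  refine (memLp_finsetSum Finset.univ fun j _ => h j).ae_eq (.of_forall fun x => ?_)
  simp [Matrix.toLpLin_apply, Matrix.mulVec, dotProduct]

theorem inner_toEuclideanLin_of_isSymm {A : Matrix (Fin 3) (Fin 3) ℝ} (hA : A.IsSymm)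
    (u v : E3) :
    inner ℝ (Matrix.toEuclideanLin A u) v = inner ℝ u (Matrix.toEuclideanLin A v) := by
  have h10 := hA.apply 0 1
  have h20 := hA.apply 0 2
  have h21 := hA.apply 1 2
  simp only [PiLp.inner_apply, Matrix.toLpLin_apply, Matrix.mulVec, dotProduct,
    Fin.sum_univ_three, RCLike.inner_apply, conj_trivial, h10, h20, h21]
  ring

/-- Coercivity makes the integrand nonnegative, so a zero integral forces it, and with it `‖∇s‖²`,
to vanish a.e. -/
theorem grad_ae_eq_zero_of_energy_eq_zero {ε : E3 → Matrix (Fin 3) (Fin 3) ℝ}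
    (hε : IsCoefficient Ω ε) {s : H1 Ω}
    (h : ∫ x in (Ω : Set E3), inner ℝ (grad s x) (Matrix.toEuclideanLin (ε x) (grad s x)) = 0) :
    grad s =ᵐ[volume.restrict (Ω : Set E3)] 0 := by
  obtain ⟨c, hc, hpos⟩ := hε.uniformlyPosDef
  have hint : Integrable (fun x => inner ℝ (grad s x) (Matrix.toEuclideanLin (ε x) (grad s x)))
      (volume.restrict (Ω : Set E3)) :=
    (L2.integrable_inner (𝕜 := ℝ) (grad s) ((hε.memLp (Lp.memLp (grad s))).toLp _)).congr
      ((hε.memLp (Lp.memLp (grad s))).coeFn_toLp.mono fun x hx => by simp only [hx])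
  have h0 := (integral_eq_zero_iff_of_nonneg_ae
    (hpos.mono fun x hx => le_trans (by positivity) (hx (grad s x))) hint).1 h
  filter_upwards [h0, hpos] with x h1 h2
  have h3 := h2 (grad s x)
  rw [h1, Pi.zero_apply] at h3
  have h4 : ‖grad s x‖ ^ 2 ≤ 0 := by
    by_contra hlt
    exact absurd h3 (not_le.2 (mul_pos hc (not_le.1 hlt)))
  simpa using le_antisymm h4 (by positivity)

end DivCurl

/-- If `g` is divergence-free with zero flux through every inner boundary component, every solution
`(u, s)` of the extended weak formulation satisfies `∇·(εu) = f` and `∇×u = g` in `Ω`, `s = 0` in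
`Ω`, and `εu·n = φ₁` in `H^{-1/2}(∂Ω)`. -/
theorem mainTheorem6 (Ω : TopologicalSpace.Opens E3)
    (hbdd : Bornology.IsBounded (Ω : Set E3)) (hconn : IsConnected (Ω : Set E3))
    (hpoly : IsPolyhedral (Ω : Set E3))
    (L : ℕ) (Γ : Fin (L + 1) → Set E3) (hΓ : IsBoundaryDecomposition (Ω : Set E3) L Γ)
    (ε : E3 → Matrix (Fin 3) (Fin 3) ℝ) (hε : IsCoefficient Ω ε)
    (f : E3 → ℝ) (hf : MeasureTheory.IntegrableOn f (Ω : Set E3))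
    (hf' : ∀ φ : H1 Ω, MeasureTheory.IntegrableOn (fun x => f x * toL2 φ x) (Ω : Set E3))
    (g : L2Vec Ω) (hdiv : HasWeakDiv Ω g 0) (hflux : ∀ i : Fin L, HasFlux Ω Γ g 0 i.succ 0)
    (φ₁ : DualTraceSpace Ω) (u : L2Vec Ω) (s : H1 Ω)
    (hus : IsExtendedWeakSolution Γ ε f g φ₁ u s) :
    HasWeakDiv Ω (fun x => Matrix.toEuclideanLin (ε x) (u x)) f ∧
    HasWeakCurl Ω u g ∧
    s = 0 ∧
    ∀ φ : H1 Ω,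
      normalTrace (fun x => Matrix.toEuclideanLin (ε x) (u x)) f φ = φ₁ (trace Ω φ) := by
  have hzero : MemH0Curl (0 : L2Vec Ω) 0 := by
    refine memH0Curl_of_green hbdd fun w => ?_
    rw [integral_inner_zero_left, integral_inner_zero_left]
  have hnormal : ∀ φ : H1 Ω,
      normalTrace (fun x => Matrix.toEuclideanLin (ε x) (u x)) f φ = φ₁ (trace Ω φ) := by
    intro φ
    -- With `ψ = 0` only `(u, ε∇φ)` survives on the left; symmetry moves `ε` onto `u`, giving
    -- Green's formula.
    have h := hus.2 φ 0 0 hzero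
    have h0 := Lp.coeFn_zero E3 2 (volume.restrict (Ω : Set E3))
    have e1 : ∫ x in (Ω : Set E3),
        inner ℝ (u x) (Matrix.toEuclideanLin (ε x) (grad φ x) + (0 : L2Vec Ω) x)
        = ∫ x in (Ω : Set E3), inner ℝ (Matrix.toEuclideanLin (ε x) (u x)) (grad φ x) := by
      refine integral_congr_ae ?_
      filter_upwards [h0, hε.isSymm] with x h1 h2
      rw [h1, Pi.zero_apply, add_zero, inner_toEuclideanLin_of_isSymm h2]
    rw [bilinearForm, linearForm, e1, integral_inner_zero_left, integral_inner_zero_right] at h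
    rw [normalTrace]
    linarith
  have hφ0 : ∀ ψ : L2Vec Ω, linearForm f g φ₁ 0 ψ = ∫ x in (Ω : Set E3), inner ℝ (g x) (ψ x) := by
    intro ψ
    have e : ∫ x in (Ω : Set E3), f x * toL2 (0 : H1 Ω) x = 0 :=
      integral_eq_zero_of_ae (toL2_zero_ae.mono fun x hx => by simp [hx])
    rw [linearForm, e, map_zero, map_zero, sub_zero, add_zero]
  have hφ0' : ∀ ψ c : L2Vec Ω, bilinearForm ε u s 0 ψ c
      = (∫ x in (Ω : Set E3), inner ℝ (u x) (c x))
        + ∫ x in (Ω : Set E3), inner ℝ (ψ x) (Matrix.toEuclideanLin (ε x) (grad s x)) := by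
    intro ψ c
    rw [bilinearForm]
    congr 1
    refine integral_congr_ae (grad_zero_ae.mono fun x hx => ?_)
    simp [hx]
  -- The divergence condition handles test functions, and the zero fluxes handle the functions `χ
  -- i`.
  have hgs : ∫ x in (Ω : Set E3), inner ℝ (g x) (grad s x) = 0 := by
    choose χ hχ1 hχ0 hχg using hflux
    refine integral_inner_grad_eq_zero_of_memH10c hbdd hΓ (Lp.memLp g) (fun v hv => ?_) (χ := χ)
      (fun i j => ?_) (fun i => ?_) hus.1
    · obtain ⟨η, -, hη⟩ := exists_gradient_of_mem_testH1 hbdd hv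
      rw [integral_congr_ae (hη.mono fun x hx => by rw [hx]), hdiv η]
      simp
    · by_cases hj : j = i.succ
      · subst hj
        simpa using hχ1 i
      · simpa [hj] using hχ0 i j hj
    · simpa [normalTrace] using hχg i
  have hs0 : s = 0 := by
    -- The test field `∇s` has zero curl, so `u` disappears and only the energy of `s` is left.
    have h := hus.2 0 (grad s) 0 (memH0Curl_grad hbdd hΓ hus.1)
    rw [hφ0, hφ0', hgs, integral_inner_zero_right, zero_add] at h
    exact eq_zero_of_grad_eq_zero hbdd hconn hpoly.1 hΓ hus.1.1
      (grad_ae_eq_zero_of_energy_eq_zero hε h)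
  refine ⟨fun η => ?_, fun w => ?_, hs0, hnormal⟩
  · obtain ⟨v, hv, hvg⟩ := exists_H1_of_contDiff (Ω := Ω) hbdd η.contDiff
    -- A test function has zero trace, so the normal trace identity reduces to the distributional
    -- divergence.
    have htr : trace Ω v = 0 := (Submodule.Quotient.mk_eq_zero _).2 (testH1_le_H10 ⟨η, hv⟩)
    have h := hnormal v
    rw [htr, map_zero, normalTrace, add_eq_zero_iff_eq_neg] at h
    have e1 : ∫ x in (Ω : Set E3), inner ℝ (Matrix.toEuclideanLin (ε x) (u x)) (gradient η x)
        = ∫ x in (Ω : Set E3), inner ℝ (Matrix.toEuclideanLin (ε x) (u x)) (grad v x) :=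
      integral_congr_ae (hvg.mono fun x hx => by simp only [hx])
    have e2 : ∫ x in (Ω : Set E3), f x * η x = ∫ x in (Ω : Set E3), f x * toL2 v x :=
      integral_congr_ae (hv.mono fun x hx => by simp only [hx])
    rw [e1, e2, h]
  · obtain ⟨ψ, c, hψc, hψ, hc⟩ := exists_memH0Curl_testFunction hbdd w
    have h := hus.2 0 ψ c hψc
    have e : ∫ x in (Ω : Set E3), inner ℝ (ψ x) (Matrix.toEuclideanLin (ε x) (grad s x)) = 0 := by
      rw [hs0]
      exact integral_eq_zero_of_ae (grad_zero_ae.mono fun x hx => by simp [hx])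
    rw [hφ0, hφ0', e, add_zero] at h
    have e1 : ∫ x in (Ω : Set E3), inner ℝ (u x) (curl w x)
        = ∫ x in (Ω : Set E3), inner ℝ (u x) (c x) :=
      integral_congr_ae (hc.mono fun x hx => by simp only [hx])
    have e2 : ∫ x in (Ω : Set E3), inner ℝ (g x) (w x)
        = ∫ x in (Ω : Set E3), inner ℝ (g x) (ψ x) :=
      integral_congr_ae (hψ.mono fun x hx => by simp only [hx])
    rw [e1, e2, h]
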